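/- All simplicial complexes are finite. For a finite set $S$, let $\Delta(S)$ denote the simplex spanned by $S$ (all subsets of $S$) and $\partial\Delta(S)$ its boundary (all proper subsets of $S$); put $\Delta^d=\Delta(\{0,\dots,d\})$ for $d\ge 0$. Let $V_K$ denote the vertex set of $K$, $K*L$ the join, $K+L$ the union, and $lk(\tau,K)$ the link of a simplex $\tau\in K$. Two complexes are PL-isomorphic if they have a common subdivision (that is, their geometric realizations have simplicially isomorphic subdivisions). A combinatorial $d$-ball is a complex PL-isomorphic to $\Delta^d$. For a non-empty simplex $\tau\in K$ and a vertex $a\notin K$, the elementary starring $(\tau,a)K$ is the complex obtained from $K$ by removing the star $\tau*lk(\tau,K)$ and replacing it with $a*\partial\tau*lk(\tau,K)$. A complex is vertex-minimal if it is a simplex or if, for $n$ its dimension, it has exactly $n+2$ vertices. \textbf{Lemma.} Let $d\ge 0$ and let $B$ be a combinatorial $d$-ball. The following statements are equivalent. \begin{enumerate} \item $|V_B|\le d+2$; equivalently, $B$ is vertex-minimal. \item $B$ is (simplicially isomorphic to) an elementary starring $(\tau,a)\Delta^d$ of $\Delta^d$, for some non-empty simplex $\tau\in\Delta^d$ and some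 vertex $a\notin\Delta^d$. \item Up to a simplicial isomorphism of $B$ (a relabelling of its vertices), there is a combinatorial $d$-ball $L$ with $B+L=\partial\Delta^{d+1}$. \end{enumerate} -/

import Mathlib

/-!
Abstract simplicial complexes are Mathlib's `PreAbstractSimplicialComplex`, which records the
nonempty faces only. So `⊥` plays the role of the complex `{∅}` whose only simplex is empty.
-/

namespace PreAbstractSimplicialComplex

/-- The vertex set `V_K` of `K`. -/
def vertexSet {V : Type*} (K : PreAbstractSimplicialComplex V) : Set V :=
  {v | {v} ∈ K.faces}

/-- The simplex `Δ(S)` spanned by a finite set `S`. -/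
def simplex {V : Type*} (S : Finset V) : PreAbstractSimplicialComplex V where
  faces := {s | s.Nonempty ∧ s ⊆ S}
  isRelLowerSet_faces := fun _ hs => ⟨hs.1, fun _ ht hn => ⟨hn, ht.trans hs.2⟩⟩

/-- The boundary `∂Δ(S)` of the simplex spanned by `S`. -/
def boundary {V : Type*} (S : Finset V) : PreAbstractSimplicialComplex V where
  faces := {s | s.Nonempty ∧ s ⊂ S}
  isRelLowerSet_faces := fun _ hs => ⟨hs.1, fun _ ht hn => ⟨hn, lt_of_le_of_lt ht hs.2⟩⟩

/-- The standard simplex `Δ^d = Δ({0, …, d})`. -/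
def standardSimplex (d : ℕ) : PreAbstractSimplicialComplex ℕ := simplex (Finset.range (d + 1))

/-- The boundary `∂Δ^d` of the standard `d`-simplex. -/
def standardBoundary (d : ℕ) : PreAbstractSimplicialComplex ℕ := boundary (Finset.range (d + 1))

/-- The join `K ∗ L`; used for complexes with disjoint vertex sets. Its simplices are the unions
of a (possibly empty) simplex of `K` and a (possibly empty) simplex of `L`. -/
def join {V : Type*} [DecidableEq V] (K L : PreAbstractSimplicialComplex V) :
    PreAbstractSimplicialComplex V where
  faces := {u | u.Nonempty ∧ ∃ s t : Finset V,
    (s = ∅ ∨ s ∈ K.faces) ∧ (t = ∅ ∨ t ∈ L.faces) ∧ u = s ∪ t}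
  isRelLowerSet_faces := by
    rintro _ ⟨hu, s, t, hs, ht, rfl⟩
    refine ⟨hu, fun w hw hn => ⟨hn, w ∩ s, w ∩ t, ?_, ?_, ?_⟩⟩
    · rcases (w ∩ s).eq_empty_or_nonempty with h | h
      · exact Or.inl h
      · rcases hs with rfl | hs
        · simp at h
        · exact Or.inr ((K.isRelLowerSet_faces hs).2 Finset.inter_subset_right h)
    · rcases (w ∩ t).eq_empty_or_nonempty with h | h
      · exact Or.inl h
      · rcases ht with rfl | ht
        · simp at h
        · exact Or.inr ((L.isRelLowerSet_faces ht).2 Finset.inter_subset_right h)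
    · rw [← Finset.inter_union_distrib_left, Finset.inter_eq_left.2 hw]

/-- The link `lk(τ, K)`. -/
def link {V : Type*} [DecidableEq V] (τ : Finset V) (K : PreAbstractSimplicialComplex V) :
    PreAbstractSimplicialComplex V where
  faces := {s | s.Nonempty ∧ Disjoint s τ ∧ s ∪ τ ∈ K.faces}
  isRelLowerSet_faces := by
    rintro s ⟨hs, hd, hK⟩
    exact ⟨hs, fun t ht hn => ⟨hn, hd.mono_left ht,
      (K.isRelLowerSet_faces hK).2 (Finset.union_subset_union_left ht)
        (hn.mono Finset.subset_union_left)⟩⟩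

/-- The (closed) star `st(τ, K) = τ ∗ lk(τ, K)`. -/
def closedStar {V : Type*} [DecidableEq V] (τ : Finset V) (K : PreAbstractSimplicialComplex V) :
    PreAbstractSimplicialComplex V :=
  join (simplex τ) (link τ K)

/-- The elementary starring `(τ, a)K`, for a nonempty simplex `τ ∈ K` and `a` not a vertex of `K`:
the star `τ ∗ lk(τ, K)` is removed and replaced with `a ∗ ∂τ ∗ lk(τ, K)`. -/
def starring {V : Type*} [DecidableEq V] (τ : Finset V) (a : V)
    (K : PreAbstractSimplicialComplex V) : PreAbstractSimplicialComplex V where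
  faces := (K.faces \ (closedStar τ K).faces) ∪
    (join (simplex {a}) (join (boundary τ) (link τ K))).faces
  isRelLowerSet_faces := by
    rintro s (⟨hsK, hst⟩ | hs)
    · have hτ : ¬ τ ⊆ s := by
        intro h
        apply hst
        refine ⟨(K.isRelLowerSet_faces hsK).1, τ, s \ τ, ?_, ?_, ?_⟩
        · rcases τ.eq_empty_or_nonempty with h0 | h0
          · exact Or.inl h0
          · exact Or.inr ⟨h0, subset_rfl⟩
        · rcases (s \ τ).eq_empty_or_nonempty with h0 | h0
          · exact Or.inl h0
          · refine Or.inr ⟨h0, Finset.sdiff_disjoint, ?_⟩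
            rwa [Finset.sdiff_union_of_subset h]
        · rw [Finset.union_sdiff_of_subset h]
      refine ⟨(K.isRelLowerSet_faces hsK).1, fun t ht hn => ?_⟩
      by_cases h : t ∈ (closedStar τ K).faces
      · right
        obtain ⟨-, x, y, hx, hy, rfl⟩ := h
        refine ⟨hn, ∅, x ∪ y, Or.inl rfl, Or.inr ⟨hn, x, y, ?_, hy, rfl⟩, by simp⟩
        rcases hx with rfl | hx
        · exact Or.inl rfl
        · refine Or.inr ⟨hx.1, hx.2, fun h' => hτ ?_⟩
          exact (h'.trans Finset.subset_union_left).trans ht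
      · exact Or.inl ⟨(K.isRelLowerSet_faces hsK).2 ht hn, h⟩
    · have := (join (simplex {a}) (join (boundary τ) (link τ K))).isRelLowerSet_faces hs
      exact ⟨this.1, fun t ht hn => Or.inr (this.2 ht hn)⟩

/-- Simplicial isomorphism: a bijection of the vertex sets that preserves simplices in both
directions. -/
def Isomorphic {V W : Type*} (K : PreAbstractSimplicialComplex V)
    (L : PreAbstractSimplicialComplex W) : Prop :=
  ∃ e : K.vertexSet ≃ L.vertexSet, ∀ s : Finset K.vertexSet,
    s.map (Function.Embedding.subtype _) ∈ K.faces ↔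
      (s.map e.toEmbedding).map (Function.Embedding.subtype _) ∈ L.faces

/-- `K` has dimension `d`. -/
def HasDim {V : Type*} (K : PreAbstractSimplicialComplex V) (d : ℕ) : Prop :=
  (∃ s ∈ K.faces, s.card = d + 1) ∧ ∀ s ∈ K.faces, s.card ≤ d + 1

/-- A vertex-minimal complex: a simplex, or a complex of some dimension `d` with exactly `d + 2`
vertices. -/
def IsVertexMinimal {V : Type*} (K : PreAbstractSimplicialComplex V) : Prop :=
  (∃ S : Finset V, K = simplex S) ∨ ∃ d : ℕ, K.HasDim d ∧ K.vertexSet.ncard = d + 2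

open Classical in
/-- The geometric realization of `K`, with the vertex `v` placed at the basis vector `v` of
the real vector space with basis `V`. -/
noncomputable def realization {V : Type*} (K : PreAbstractSimplicialComplex V) :
    Geometry.SimplicialComplex ℝ (V →₀ ℝ) :=
  Geometry.SimplicialComplex.onFinsupp K

/-- `K'` is a (finite) subdivision of the geometric simplicial complex `K`: both have the same
underlying space, and each simplex of `K'` is contained in a simplex of `K`. -/
def IsSubdivision {E : Type*} [AddCommGroup E] [Module ℝ E]
    (K' K : Geometry.SimplicialComplex ℝ E) : Prop :=
  K'.faces.Finite ∧ K'.space = K.space ∧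
    ∀ s ∈ K'.faces, ∃ t ∈ K.faces, convexHull ℝ (s : Set E) ⊆ convexHull ℝ (t : Set E)

/-- `K` and `L` are PL-isomorphic: they have a common subdivision, that is, simplicially
isomorphic subdivisions. -/
def PLIsomorphic {V W : Type*} (K : PreAbstractSimplicialComplex V)
    (L : PreAbstractSimplicialComplex W) : Prop :=
  ∃ (K' : Geometry.SimplicialComplex ℝ (V →₀ ℝ)) (L' : Geometry.SimplicialComplex ℝ (W →₀ ℝ)),
    IsSubdivision K' K.realization ∧ IsSubdivision L' L.realization ∧
      Isomorphic K'.toPreAbstractSimplicialComplex L'.toPreAbstractSimplicialComplex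

/-- A combinatorial `d`-ball: a finite complex that is PL-isomorphic to `Δ^d`. -/
def IsCombinatorialBall {V : Type*} (d : ℕ) (K : PreAbstractSimplicialComplex V) : Prop :=
  K.faces.Finite ∧ PLIsomorphic K (standardSimplex d)

end PreAbstractSimplicialComplex

/-!
The complex `boundaryJoin T S = ∂Δ(T) ∗ Δ(S \ T)`, whose simplices are the nonempty subsets of `S`
that do not contain `T`, links all the conditions. For a nonempty face `τ` of `Δ^d` the starring
`(τ, a)Δ^d` is `boundaryJoin τ S` with `S = {0, …, d, a}` (`starring_simplex`), and the union of
`boundaryJoin T S` and `boundaryJoin (S \ T) S` is `∂Δ(S)`.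

Conversely, let `B` be a `d`-ball with at most `d + 2` vertices. A ball is pure of dimension `d`
(`IsCombinatorialBall.isPure`). If `B` has `d + 1` vertices, it is therefore a simplex. If its
vertex set `S` has `d + 2` elements, its facets are the sets `S \ {v}` with `v` in some `T ⊆ S`, so
that `B = boundaryJoin T S` (`IsPure.eq_simplex_or_eq_boundaryJoin`). Here `T ≠ S`, since
`boundaryJoin S S = ∂Δ(S)` is a sphere and not a ball (`not_isCombinatorialBall_boundary`); hence
`B` is a starring, in which any vertex outside `T` plays the role of `a`. For the complementary ball
one also needs that starrings of the simplex are balls (`isCombinatorialBall_boundaryJoin`): the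
linear map that sends `a` to the barycentre of `τ` identifies the realization of the starring with
a subdivision of the simplex.

The two facts about subdivisions, purity and the difference between sphere and ball, need neither
measure nor homology. A segment issuing from a point `x` inside a finite complex has an initial part
inside one face (`exists_face_contains_initial_segment`), and if `x` is the barycentre of a face
`s`, that face contains `s`. Moving from the barycentre of a face of too small a dimension towards a
point outside its span thus produces a larger face, which gives purity, also inside each closed cell
of the subdivided complex (`IsSubdivision.exists_superset_card_eq`). Call a `(d-1)`-face free if it
is contained in exactly one `d`-face. A subdivision of `Δ^d` has a free face, on the boundary
(`IsSubdivision.hasFreeRidge`), whereas in a subdivision of `∂Δ^{d+1}` every `(d-1)`-face can be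
left on two sides (`IsSubdivision.not_hasFreeRidge_of_boundary`).
-/

namespace PreAbstractSimplicialComplex

open Finsupp Module

/-! ### Barycentric coordinates -/

section Coordinates

variable {E : Type*} [AddCommGroup E] [Module ℝ E]

/-- The barycentric coordinates of a linearly independent set, extended to linear forms on the
whole space. -/
theorem exists_coordinates {s : Finset E} (hs : LinearIndepOn ℝ id (s : Set E)) :
    ∃ c : E → E →ₗ[ℝ] ℝ, ∀ (w : E → ℝ), ∀ p ∈ s, c p (∑ q ∈ s, w q • q) = w p := by
  classical
  let b := Basis.extend hs
  have hsub := hs.subset_extend (Set.subset_univ _)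
  refine ⟨fun p => if hp : p ∈ s then b.coord ⟨p, hsub hp⟩ else 0, fun w p hp => ?_⟩
  simp only [hp, dif_pos, map_sum, map_smul, smul_eq_mul]
  rw [Finset.sum_eq_single p]
  · have : b.coord ⟨p, hsub hp⟩ p = 1 := by
      have h := Basis.extend_apply_self hs ⟨p, hsub hp⟩
      have h' : b.coord ⟨p, hsub hp⟩ (b ⟨p, hsub hp⟩) = 1 := by simp
      rwa [h] at h'
    rw [this, mul_one]
  · intro q hq hqp
    have : b.coord ⟨p, hsub hp⟩ q = 0 := by
      have h := Basis.extend_apply_self hs ⟨q, hsub hq⟩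
      have h' : b.coord ⟨p, hsub hp⟩ (b ⟨q, hsub hq⟩) = 0 := by
        simp [hqp]
      rwa [h] at h'
    rw [this, mul_zero]
  · exact fun h => absurd hp h

/-- The barycentre of a finite set of points. -/
noncomputable def barycenter (s : Finset E) : E := ∑ p ∈ s, (s.card : ℝ)⁻¹ • p

theorem barycenter_mem_convexHull {s : Finset E} (hs : s.Nonempty) :
    barycenter s ∈ convexHull ℝ (s : Set E) := by
  rw [Finset.mem_convexHull']
  refine ⟨fun _ => (s.card : ℝ)⁻¹, fun _ _ => by positivity, ?_, rfl⟩
  have : (s.card : ℝ) ≠ 0 := by exact_mod_cast hs.card_pos.ne'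
  simp [this]

theorem convexHull_subset_span (s : Set E) : convexHull ℝ s ⊆ Submodule.span ℝ s :=
  convexHull_min Submodule.subset_span (Submodule.convex _)

/-- A face of a geometric complex whose convex hull contains the barycentre of another face
contains that face. -/
theorem subset_of_barycenter_mem {K : Geometry.SimplicialComplex ℝ E} {s t : Finset E}
    (hs : s ∈ K.faces) (hli : LinearIndepOn ℝ id (s : Set E)) (ht : t ∈ K.faces)
    (h : barycenter s ∈ convexHull ℝ (t : Set E)) : s ⊆ t := by
  classical
  have hne := K.nonempty_of_mem_faces hs
  have h2 := K.inter_subset_convexHull hs ht ⟨barycenter_mem_convexHull hne, h⟩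
  rw [← Finset.coe_inter, Finset.mem_convexHull'] at h2
  obtain ⟨w, -, -, hw⟩ := h2
  obtain ⟨c, hc⟩ := exists_coordinates hli
  intro p hp
  by_contra hpt
  have h3 := hc (fun _ => (s.card : ℝ)⁻¹) p hp
  have h4 := hc (fun q => if q ∈ t then w q else 0) p hp
  have h5 : ∑ q ∈ s, (if q ∈ t then w q else 0) • q = barycenter s := by
    rw [← hw, ← Finset.filter_mem_eq_inter, Finset.sum_filter]
    exact Finset.sum_congr rfl fun q _ => by split_ifs <;> simp
  rw [h5] at h4
  change c p (barycenter s) = _ at h3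
  rw [h3] at h4
  simp [hpt, hne.ne_empty] at h4

/-- Points of the span of `s` with nonnegative coordinates are in the convex hull of `s`, as soon
as they lie in the affine hyperplane `φ = 1` that contains `s`. -/
theorem mem_convexHull_of_coordinates {φ : E →ₗ[ℝ] ℝ} {s : Finset E} (hφ : ∀ p ∈ s, φ p = 1)
    {c : E → E →ₗ[ℝ] ℝ} (hc : ∀ (w : E → ℝ), ∀ p ∈ s, c p (∑ q ∈ s, w q • q) = w p)
    {z : E} (hz : z ∈ Submodule.span ℝ (s : Set E)) (hz1 : φ z = 1)
    (h0 : ∀ p ∈ s, 0 ≤ c p z) : z ∈ convexHull ℝ (s : Set E) := by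
  obtain ⟨w, -, rfl⟩ := Submodule.mem_span_finset.1 hz
  rw [Finset.mem_convexHull']
  refine ⟨w, fun p hp => hc w p hp ▸ h0 p hp, ?_, rfl⟩
  rw [map_sum] at hz1
  rw [← hz1]
  exact Finset.sum_congr rfl fun p hp => by simp [hφ p hp]

theorem coordinates_nonneg {s : Finset E} {c : E → E →ₗ[ℝ] ℝ}
    (hc : ∀ (w : E → ℝ), ∀ p ∈ s, c p (∑ q ∈ s, w q • q) = w p) {z : E}
    (hz : z ∈ convexHull ℝ (s : Set E)) {p : E} (hp : p ∈ s) : 0 ≤ c p z := by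
  obtain ⟨w, hw, -, rfl⟩ := Finset.mem_convexHull'.1 hz
  rw [hc w p hp]
  exact hw p hp

/-- In a finite complex, a segment issuing from `x` inside the underlying space has an initial
part inside a single face. -/
theorem exists_face_contains_initial_segment {K : Geometry.SimplicialComplex ℝ E}
    (hfin : K.faces.Finite) {φ : E →ₗ[ℝ] ℝ} (hφ : ∀ s ∈ K.faces, ∀ p ∈ s, φ p = 1)
    (hli : ∀ s ∈ K.faces, LinearIndepOn ℝ id (s : Set E)) {x v : E} (hx : φ x = 1)
    (h : ∀ n : ℕ, x + (1 / ((n : ℝ) + 1)) • v ∈ K.space) :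
    ∃ s ∈ K.faces, x ∈ convexHull ℝ (s : Set E) ∧
      ∃ δ : ℝ, 0 < δ ∧ x + δ • v ∈ convexHull ℝ (s : Set E) := by
  have h1 : ∀ n : ℕ, ∃ s : K.faces, x + (1 / ((n : ℝ) + 1)) • v ∈ convexHull ℝ (s : Set E) := by
    intro n
    obtain ⟨s, hs, hxs⟩ := Geometry.SimplicialComplex.mem_space_iff.1 (h n)
    exact ⟨⟨s, hs⟩, hxs⟩
  choose f hf using h1
  -- infinitely many of the points, which tend to `x`, are in the same face
  have := hfin.to_subtype
  obtain ⟨⟨s, hs⟩, hinf⟩ := Finite.exists_infinite_fiber f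
  rw [Set.infinite_coe_iff] at hinf
  have hmem : ∀ n ∈ f ⁻¹' {⟨s, hs⟩}, x + (1 / ((n : ℝ) + 1)) • v ∈ convexHull ℝ (s : Set E) := by
    intro n hn
    have := hf n
    rwa [show f n = ⟨s, hs⟩ from hn] at this
  obtain ⟨n, hn⟩ := hinf.nonempty
  obtain ⟨m, hm, hnm⟩ := hinf.exists_gt n
  refine ⟨s, hs, ?_, _, by positivity, hmem n hn⟩
  obtain ⟨c, hc⟩ := exists_coordinates (hli s hs)
  refine mem_convexHull_of_coordinates (hφ s hs) hc ?_ hx fun p hp => ?_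
  · -- `x` is on the line through two points of the face
    have hn' := convexHull_subset_span _ (hmem n hn)
    have hm' := convexHull_subset_span _ (hmem m hm)
    have h3 := Submodule.smul_mem _ (1 / ((m : ℝ) - n)) (Submodule.sub_mem _
      (Submodule.smul_mem _ ((m : ℝ) + 1) hm') (Submodule.smul_mem _ ((n : ℝ) + 1) hn'))
    have hne : (m : ℝ) - n ≠ 0 := by
      have : (n : ℝ) < m := by exact_mod_cast hnm
      linarith
    convert! h3 using 1
    rw [smul_add, smul_add, smul_smul, smul_smul, mul_one_div_cancel (by positivity),
      mul_one_div_cancel (by positivity), add_sub_add_right_eq_sub, ← sub_smul, smul_smul]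
    rw [show 1 / ((m : ℝ) - n) * (m + 1 - (n + 1)) = 1 by field_simp; ring, one_smul]
  · -- the coordinate is nonnegative at points of the segment that tend to `x`
    by_contra! hneg
    obtain ⟨N, hN⟩ := exists_nat_gt (|c p v| / (-(c p x)))
    obtain ⟨k, hk, hkN⟩ := hinf.exists_gt N
    have h4 := coordinates_nonneg hc (hmem k hk) hp
    rw [map_add, map_smul, smul_eq_mul] at h4
    rw [div_lt_iff₀ (by linarith)] at hN
    have h5 : (N : ℝ) < k := by exact_mod_cast hkN
    have h6 : 0 ≤ ((k : ℝ) + 1) * c p x + c p v := by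
      have := mul_nonneg (by positivity : (0 : ℝ) ≤ k + 1) h4
      rw [mul_add, ← mul_assoc, mul_one_div_cancel (by positivity), one_mul] at this
      exact this
    nlinarith [le_abs_self (c p v)]

/-- Finitely many affine functions that are positive at `0` are nonnegative at some point of
`(0, 1]`. -/
theorem exists_pos_forall_add_mul_nonneg {ι : Type*} (s : Finset ι) (α β : ι → ℝ)
    (h : ∀ i ∈ s, 0 < α i) : ∃ ε : ℝ, 0 < ε ∧ ε ≤ 1 ∧ ∀ i ∈ s, 0 ≤ α i + ε * β i := by
  have h1 : ∀ᶠ ε in nhdsWithin (0 : ℝ) (Set.Ioi 0), ∀ i ∈ s, 0 ≤ α i + ε * β i := by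
    rw [Filter.eventually_all_finset]
    intro i hi
    have : Filter.Tendsto (fun ε : ℝ => α i + ε * β i) (nhds 0) (nhds (α i)) := by
      have : Continuous fun ε : ℝ => α i + ε * β i := by fun_prop
      simpa using this.tendsto 0
    exact ((this.eventually (lt_mem_nhds (h i hi))).mono fun _ h => h.le).filter_mono
      nhdsWithin_le_nhds
  obtain ⟨ε, h2, h3⟩ := (h1.and (Ioc_mem_nhdsGT (zero_lt_one' ℝ))).exists
  exact ⟨ε, h3.1, h3.2, h2⟩

end Coordinates

/-! ### Cells of a realization -/

section Cells

variable {V : Type*}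

/-- The sum of the coordinates. -/
noncomputable def coordSum : (V →₀ ℝ) →ₗ[ℝ] ℝ := linearCombination ℝ fun _ => (1 : ℝ)

/-- The geometric simplex in `V →₀ ℝ` spanned by the basis vectors of `T`. -/
def cell (T : Finset V) : Set (V →₀ ℝ) :=
  {x | (∀ v, 0 ≤ x v) ∧ coordSum x = 1 ∧ x.support ⊆ T}

theorem coordSum_eq_sum {T : Finset V} {x : V →₀ ℝ} (h : x.support ⊆ T) :
    coordSum x = ∑ v ∈ T, x v := by
  rw [coordSum, linearCombination_apply, sum_of_support_subset _ h _ (by simp)]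
  simp

theorem coordSum_single (v : V) : coordSum (single v (1 : ℝ)) = 1 := by
  simp [coordSum]

theorem single_mem_cell {T : Finset V} {v : V} (hv : v ∈ T) : single v (1 : ℝ) ∈ cell T := by
  classical
  refine ⟨fun u => ?_, coordSum_single v, support_single_subset.trans (by simpa)⟩
  rw [single_apply]
  split_ifs <;> norm_num

theorem cell_mono {S T : Finset V} (h : S ⊆ T) : cell S ⊆ cell T :=
  fun _ hx => ⟨hx.1, hx.2.1, hx.2.2.trans h⟩

theorem support_nonempty_of_mem_cell {T : Finset V} {x : V →₀ ℝ} (hx : x ∈ cell T) :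
    x.support.Nonempty := by
  rw [Finset.nonempty_iff_ne_empty, Ne, Finsupp.support_eq_empty]
  rintro rfl
  simpa using hx.2.1

theorem apply_eq_zero_of_mem_cell {T : Finset V} {x : V →₀ ℝ} (hx : x ∈ cell T) {v : V}
    (hv : v ∉ T) : x v = 0 :=
  notMem_support_iff.1 fun h => hv (hx.2.2 h)

theorem mem_cell_of_apply_eq_zero {T : Finset V} {x : V →₀ ℝ} (h0 : ∀ v, 0 ≤ x v)
    (h1 : coordSum x = 1) (h : ∀ v, v ∉ T → x v = 0) : x ∈ cell T :=
  ⟨h0, h1, fun v hv => by by_contra hvT; exact (mem_support_iff.1 hv) (h v hvT)⟩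

theorem convex_cell (T : Finset V) : Convex ℝ (cell T) := by
  intro x hx y hy a b ha hb hab
  refine mem_cell_of_apply_eq_zero (fun v => ?_) ?_ fun v hv => ?_
  · have := hx.1 v
    have := hy.1 v
    simp only [coe_add, coe_smul, Pi.add_apply, Pi.smul_apply, smul_eq_mul]
    positivity
  · simp [hx.2.1, hy.2.1, hab]
  · simp [apply_eq_zero_of_mem_cell hx hv, apply_eq_zero_of_mem_cell hy hv]

theorem convexHull_image_single (T : Finset V) :
    convexHull ℝ ((fun v => single v (1 : ℝ)) '' (T : Set V)) = cell T := by
  apply Set.Subset.antisymm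
  · refine convexHull_min ?_ (convex_cell T)
    rintro _ ⟨v, hv, rfl⟩
    exact single_mem_cell hv
  · intro x hx
    have h1 : x = ∑ v ∈ T, x v • single v (1 : ℝ) := by
      conv_lhs => rw [← sum_single x, sum_of_support_subset _ hx.2.2 _ (by simp)]
      simp
    rw [h1]
    refine (convex_convexHull ℝ _).sum_mem (fun v _ => hx.1 v) ?_ fun v hv =>
      subset_convexHull ℝ _ ⟨v, hv, rfl⟩
    rw [← coordSum_eq_sum hx.2.2, hx.2.1]

theorem exists_of_mem_realization_faces {K : PreAbstractSimplicialComplex V} {s : Finset (V →₀ ℝ)}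
    (hs : s ∈ K.realization.faces) :
    ∃ T ∈ K.faces, T.card = s.card ∧ (s : Set (V →₀ ℝ)) = (fun v => single v (1 : ℝ)) '' T := by
  classical
  obtain ⟨T, hT, rfl⟩ := hs
  refine ⟨T, hT, ?_, by simp⟩
  rw [Finset.card_image_of_injective]
  exact single_left_injective one_ne_zero

theorem exists_mem_realization_faces {K : PreAbstractSimplicialComplex V} {T : Finset V}
    (hT : T ∈ K.faces) :
    ∃ s ∈ K.realization.faces, (s : Set (V →₀ ℝ)) = (fun v => single v (1 : ℝ)) '' T := by
  classical
  exact ⟨_, ⟨T, hT, rfl⟩, by simp⟩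

theorem mem_realization_space {K : PreAbstractSimplicialComplex V} {x : V →₀ ℝ} :
    x ∈ K.realization.space ↔ ∃ T ∈ K.faces, x ∈ cell T := by
  rw [Geometry.SimplicialComplex.mem_space_iff]
  constructor
  · rintro ⟨s, hs, hx⟩
    obtain ⟨T, hT, -, h⟩ := exists_of_mem_realization_faces hs
    rw [h, convexHull_image_single] at hx
    exact ⟨T, hT, hx⟩
  · rintro ⟨T, hT, hx⟩
    obtain ⟨s, hs, h⟩ := exists_mem_realization_faces hT
    refine ⟨s, hs, ?_⟩
    rwa [h, convexHull_image_single]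

theorem span_le_span_single {T : Finset V} {s : Finset (V →₀ ℝ)} (h : ∀ p ∈ s, p ∈ cell T) :
    Submodule.span ℝ (s : Set (V →₀ ℝ)) ≤
      Submodule.span ℝ ((fun v => single v (1 : ℝ)) '' (T : Set V)) := by
  rw [Submodule.span_le]
  intro p hp
  have := h p hp
  rw [← convexHull_image_single] at this
  exact convexHull_subset_span _ this

theorem finrank_span_single (T : Finset V) :
    finrank ℝ (Submodule.span ℝ ((fun v => single v (1 : ℝ)) '' (T : Set V))) = T.card := by
  classical
  have h := (Finsupp.linearIndependent_single_one ℝ V)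
  have h2 : LinearIndepOn ℝ (fun v => single v (1 : ℝ)) (T : Set V) :=
    h.linearIndepOn _
  have h3 := h2.id_image
  rw [← Finset.coe_image] at h3 ⊢
  rw [finrank_span_finset_eq_card h3, Finset.card_image_of_injective _
    (single_left_injective one_ne_zero)]

instance finiteDimensional_span_single (T : Finset V) :
    FiniteDimensional ℝ (Submodule.span ℝ ((fun v => single v (1 : ℝ)) '' (T : Set V))) :=
  FiniteDimensional.span_of_finite ℝ (T.finite_toSet.image _)

theorem card_le_of_subset_cell {T : Finset V} {s : Finset (V →₀ ℝ)}
    (hli : LinearIndepOn ℝ id (s : Set (V →₀ ℝ))) (h : ∀ p ∈ s, p ∈ cell T) :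
    s.card ≤ T.card := by
  rw [← finrank_span_finset_eq_card hli, ← finrank_span_single T]
  exact Submodule.finrank_mono (span_le_span_single h)

theorem span_eq_span_single {T : Finset V} {s : Finset (V →₀ ℝ)}
    (hli : LinearIndepOn ℝ id (s : Set (V →₀ ℝ))) (h : ∀ p ∈ s, p ∈ cell T)
    (hcard : s.card = T.card) :
    Submodule.span ℝ (s : Set (V →₀ ℝ)) =
      Submodule.span ℝ ((fun v => single v (1 : ℝ)) '' (T : Set V)) :=
  Submodule.eq_of_le_of_finrank_eq (span_le_span_single h) (by
    rw [finrank_span_finset_eq_card hli, finrank_span_single, hcard])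

theorem exists_single_notMem_span {T : Finset V} {s : Finset (V →₀ ℝ)} (hcard : s.card < T.card) :
    ∃ v ∈ T, single v (1 : ℝ) ∉ Submodule.span ℝ (s : Set (V →₀ ℝ)) := by
  by_contra! h
  have h1 : Submodule.span ℝ ((fun v => single v (1 : ℝ)) '' (T : Set V)) ≤
      Submodule.span ℝ (s : Set (V →₀ ℝ)) := by
    rw [Submodule.span_le]
    rintro _ ⟨v, hv, rfl⟩
    exact h v hv
  have h2 := Submodule.finrank_mono h1
  rw [finrank_span_single] at h2
  have := finrank_span_finset_le_card (R := ℝ) s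
  unfold Set.finrank at this
  omega

end Cells

/-! ### Subdivisions of a realization -/

section Subdivision

variable {V : Type*} {K : PreAbstractSimplicialComplex V}
  {K' : Geometry.SimplicialComplex ℝ (V →₀ ℝ)}

theorem IsSubdivision.exists_subset_cell (h : IsSubdivision K' K.realization)
    {s : Finset (V →₀ ℝ)} (hs : s ∈ K'.faces) : ∃ T ∈ K.faces, ∀ p ∈ s, p ∈ cell T := by
  obtain ⟨t, ht, hst⟩ := h.2.2 s hs
  obtain ⟨T, hT, -, hTt⟩ := exists_of_mem_realization_faces ht
  rw [hTt, convexHull_image_single] at hst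
  exact ⟨T, hT, fun p hp => hst (subset_convexHull ℝ _ hp)⟩

theorem IsSubdivision.coordSum_eq_one (h : IsSubdivision K' K.realization)
    {s : Finset (V →₀ ℝ)} (hs : s ∈ K'.faces) {p : V →₀ ℝ} (hp : p ∈ s) : coordSum p = 1 := by
  obtain ⟨T, -, hT⟩ := h.exists_subset_cell hs
  exact (hT p hp).2.1

theorem IsSubdivision.cell_subset_space (h : IsSubdivision K' K.realization) {T : Finset V}
    (hT : T ∈ K.faces) : cell T ⊆ K'.space := by
  intro x hx
  rw [h.2.1]
  exact mem_realization_space.2 ⟨T, hT, hx⟩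

/-- The vertices of a face lie in the hyperplane `coordSum = 1`, so that their affine independence
amounts to linear independence. -/
theorem IsSubdivision.linearIndepOn (h : IsSubdivision K' K.realization)
    {s : Finset (V →₀ ℝ)} (hs : s ∈ K'.faces) : LinearIndepOn ℝ id (s : Set (V →₀ ℝ)) := by
  rw [linearIndepOn_finset_iff]
  intro w hw p hp
  have h1 := affineIndependent_iff.1 (K'.indep hs) Finset.univ (fun q => w q)
  refine h1 ?_ ?_ ⟨p, hp⟩ (Finset.mem_univ _)
  · rw [Finset.univ_eq_attach, Finset.sum_attach s w]
    have := congrArg coordSum hw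
    rw [map_sum, map_zero] at this
    rw [← this]
    exact Finset.sum_congr rfl fun q hq => by simp [h.coordSum_eq_one hs hq]
  · rw [Finset.univ_eq_attach, Finset.sum_attach s fun q => w q • q]
    exact hw

theorem convexHull_subset_cell {T : Finset V} {s : Finset (V →₀ ℝ)} (h : ∀ p ∈ s, p ∈ cell T) :
    convexHull ℝ (s : Set (V →₀ ℝ)) ⊆ cell T :=
  convexHull_min h (convex_cell T)

open Classical in
/-- The cell of `U` meets the cell of `T` in a common face, so that a point of `conv s` that lies in
`cell U` is a convex combination of those vertices of `s` that are in `cell U`. -/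
theorem mem_convexHull_filter_cell {T U : Finset V} {s : Finset (V →₀ ℝ)}
    (h : ∀ p ∈ s, p ∈ cell T) {x : V →₀ ℝ} (hx : x ∈ convexHull ℝ (s : Set (V →₀ ℝ)))
    (hxU : x ∈ cell U) :
    x ∈ convexHull ℝ ((s.filter (· ∈ cell U) : Finset (V →₀ ℝ)) : Set (V →₀ ℝ)) := by
  obtain ⟨w, hw, hw1, rfl⟩ := Finset.mem_convexHull'.1 hx
  have h0 : ∀ p ∈ s, p ∉ cell U → w p = 0 := by
    intro p hp hpU
    by_contra hwp
    refine hpU (mem_cell_of_apply_eq_zero (h p hp).1 (h p hp).2.1 fun v hv => ?_)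
    have h1 := apply_eq_zero_of_mem_cell hxU hv
    rw [finsetSum_apply, Finset.sum_eq_zero_iff_of_nonneg] at h1
    · have := h1 p hp
      simpa [hwp] using this
    · intro q hq
      exact mul_nonneg (hw q hq) ((h q hq).1 v)
  rw [Finset.mem_convexHull']
  refine ⟨w, fun p hp => hw p (Finset.mem_of_mem_filter p hp), ?_, ?_⟩
  · rw [← hw1]
    refine Finset.sum_subset (Finset.filter_subset _ _) fun p hp hpU => h0 p hp fun h' => ?_
    exact hpU (Finset.mem_filter.2 ⟨hp, h'⟩)
  · refine Finset.sum_subset (Finset.filter_subset _ _) fun p hp hpU => ?_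
    rw [h0 p hp fun h' => hpU (Finset.mem_filter.2 ⟨hp, h'⟩), zero_smul]

theorem IsSubdivision.exists_face_in_cell (h : IsSubdivision K' K.realization) {T : Finset V}
    (hT : T ∈ K.faces) : ∃ s ∈ K'.faces, ∀ p ∈ s, p ∈ cell T := by
  classical
  obtain ⟨v, hv⟩ := (K.isRelLowerSet_faces hT).1
  obtain ⟨s, hs, hvs⟩ :=
    Geometry.SimplicialComplex.mem_space_iff.1 (h.cell_subset_space hT (single_mem_cell hv))
  obtain ⟨U, -, hU⟩ := h.exists_subset_cell hs
  have h1 := mem_convexHull_filter_cell hU hvs (single_mem_cell hv)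
  refine ⟨_, K'.down_closed hs (Finset.filter_subset _ _) ?_, fun p hp =>
    (Finset.mem_filter.1 hp).2⟩
  exact Finset.coe_nonempty.1 (convexHull_nonempty_iff.1 ⟨_, h1⟩)

/-- A face of a subdivision inside `cell T` of too small a dimension is not maximal among the faces
inside `cell T`: move from its barycentre towards a vertex of `cell T` outside its span. -/
theorem IsSubdivision.exists_ssubset (h : IsSubdivision K' K.realization) {T : Finset V}
    (hT : T ∈ K.faces) {s : Finset (V →₀ ℝ)} (hs : s ∈ K'.faces) (hsT : ∀ p ∈ s, p ∈ cell T)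
    (hcard : s.card < T.card) : ∃ s' ∈ K'.faces, s ⊂ s' ∧ ∀ p ∈ s', p ∈ cell T := by
  classical
  obtain ⟨v, hv, hvs⟩ := exists_single_notMem_span hcard
  have hne := K'.nonempty_of_mem_faces hs
  have hx := barycenter_mem_convexHull hne
  have hxT := convexHull_subset_cell hsT hx
  have hseg : ∀ ε : ℝ, 0 ≤ ε → ε ≤ 1 →
      barycenter s + ε • (single v (1 : ℝ) - barycenter s) ∈ cell T := by
    intro ε h0 h1
    have := convex_cell T hxT (single_mem_cell hv) (sub_nonneg.2 h1) h0 (by ring)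
    convert! this using 1
    module
  obtain ⟨t, ht, hxt, δ, hδ, hyt⟩ := exists_face_contains_initial_segment h.1
    (fun s hs p hp => h.coordSum_eq_one hs hp) (fun s hs => h.linearIndepOn hs) hxT.2.1
    (fun n => h.cell_subset_space hT (hseg (1 / ((n : ℝ) + 1)) (by positivity)
      (by rw [div_le_one (by positivity)]; linarith [(Nat.cast_nonneg n : (0 : ℝ) ≤ n)])))
  -- shorten the segment, so as to stay inside the cell
  have hyt' : barycenter s + (min δ 1) • (single v (1 : ℝ) - barycenter s) ∈
      convexHull ℝ (t : Set (V →₀ ℝ)) := by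
    have h1 : min δ 1 / δ ≤ 1 := by rw [div_le_one hδ]; exact min_le_left _ _
    have := (convex_convexHull ℝ (t : Set (V →₀ ℝ))) hxt hyt (sub_nonneg.2 h1)
      (by positivity : 0 ≤ min δ 1 / δ) (by ring)
    convert! this using 1
    have h2 : min δ 1 = min δ 1 / δ * δ := by field_simp
    rw [smul_add, smul_smul, ← h2]
    module
  obtain ⟨U, -, hU⟩ := h.exists_subset_cell ht
  have hx' := mem_convexHull_filter_cell hU hxt hxT
  have hy' := mem_convexHull_filter_cell hU hyt' (hseg _ (by positivity) (min_le_right _ _))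
  have htf : t.filter (· ∈ cell T) ∈ K'.faces :=
    K'.down_closed ht (Finset.filter_subset _ _)
      (Finset.coe_nonempty.1 (convexHull_nonempty_iff.1 ⟨_, hx'⟩))
  have hsub := subset_of_barycenter_mem hs (h.linearIndepOn hs) htf hx'
  refine ⟨_, htf, hsub.ssubset_of_ne fun heq => hvs ?_, fun p hp => (Finset.mem_filter.1 hp).2⟩
  rw [← heq] at hx' hy'
  have hx2 := convexHull_subset_span _ hx'
  have hy2 := convexHull_subset_span _ hy'
  have hpos : 0 < min δ 1 := by positivity
  have h3 := Submodule.add_mem _ hx2 (Submodule.smul_mem _ (min δ 1)⁻¹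
    (Submodule.sub_mem _ hy2 hx2))
  rw [add_sub_cancel_left, smul_smul, inv_mul_cancel₀ hpos.ne', one_smul,
    add_sub_cancel] at h3
  exact h3

/-- Relative purity: the faces of a subdivision inside a closed cell extend, inside that cell, to
faces of the dimension of the cell. -/
theorem IsSubdivision.exists_superset_card_eq (h : IsSubdivision K' K.realization) {T : Finset V}
    (hT : T ∈ K.faces) {s : Finset (V →₀ ℝ)} (hs : s ∈ K'.faces) (hsT : ∀ p ∈ s, p ∈ cell T) :
    ∃ s' ∈ K'.faces, s ⊆ s' ∧ (∀ p ∈ s', p ∈ cell T) ∧ s'.card = T.card := by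
  induction hn : T.card - s.card using Nat.strong_induction_on generalizing s with
  | _ n ih =>
    rcases (card_le_of_subset_cell (h.linearIndepOn hs) hsT).eq_or_lt with heq | hlt
    · exact ⟨s, hs, subset_rfl, hsT, heq⟩
    · obtain ⟨t, ht, hst, htT⟩ := h.exists_ssubset hT hs hsT hlt
      have := Finset.card_lt_card hst
      obtain ⟨s', h1, h2, h3⟩ := ih _ (by omega) ht htT rfl
      exact ⟨s', h1, hst.subset.trans h2, h3⟩

end Subdivision

/-! ### Pure complexes and free ridges -/

section Pure

variable {V W : Type*}

/-- `K` is nonempty and pure of dimension `d`: each simplex is contained in a `d`-simplex, and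
there are no simplices of higher dimension. -/
def IsPure (K : PreAbstractSimplicialComplex V) (d : ℕ) : Prop :=
  K.faces.Nonempty ∧ (∀ s ∈ K.faces, s.card ≤ d + 1) ∧
    ∀ s ∈ K.faces, ∃ t ∈ K.faces, s ⊆ t ∧ t.card = d + 1

/-- Some `(d-1)`-simplex of `K` is contained in exactly one `d`-simplex (for `0 < d`). -/
def HasFreeRidge (K : PreAbstractSimplicialComplex V) (d : ℕ) : Prop :=
  ∃ u ∈ K.faces, ∃ s ∈ K.faces, u ⊆ s ∧ u.card = d ∧ s.card = d + 1 ∧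
    ∀ t ∈ K.faces, u ⊆ t → t.card = d + 1 → t = s

theorem subset_vertexSet {K : PreAbstractSimplicialComplex V} {s : Finset V} (hs : s ∈ K.faces) :
    ∀ v ∈ s, v ∈ K.vertexSet := fun v hv =>
  (K.isRelLowerSet_faces hs).2 (Finset.singleton_subset_iff.2 hv) (Finset.singleton_nonempty v)

theorem Isomorphic.symm {K : PreAbstractSimplicialComplex V} {L : PreAbstractSimplicialComplex W}
    (h : K.Isomorphic L) : L.Isomorphic K := by
  obtain ⟨e, he⟩ := h
  refine ⟨e.symm, fun s => ?_⟩
  rw [he (s.map e.symm.toEmbedding)]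
  congr! 2
  ext; simp

/-- An isomorphism, as mutually inverse monotone maps between the faces that preserve cardinality;
these maps take arbitrary finite sets of vertices, with no condition off the faces. -/
theorem Isomorphic.exists_faceMap {K : PreAbstractSimplicialComplex V}
    {L : PreAbstractSimplicialComplex W} (h : K.Isomorphic L) :
    ∃ (Φ : Finset V → Finset W) (Ψ : Finset W → Finset V), Monotone Φ ∧ Monotone Ψ ∧
      (∀ s ∈ K.faces, Φ s ∈ L.faces ∧ (Φ s).card = s.card ∧ Ψ (Φ s) = s) ∧
      ∀ t ∈ L.faces, Ψ t ∈ K.faces ∧ (Ψ t).card = t.card ∧ Φ (Ψ t) = t := by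
  classical
  obtain ⟨e, he⟩ := h
  have hK : ∀ s ∈ K.faces, (s.subtype (· ∈ K.vertexSet)).map (Function.Embedding.subtype _) = s :=
    fun s hs => Finset.subtype_map_of_mem (subset_vertexSet hs)
  have hL : ∀ s ∈ L.faces, (s.subtype (· ∈ L.vertexSet)).map (Function.Embedding.subtype _) = s :=
    fun s hs => Finset.subtype_map_of_mem (subset_vertexSet hs)
  refine ⟨fun s => ((s.subtype (· ∈ K.vertexSet)).map e.toEmbedding).map
      (Function.Embedding.subtype _),
    fun s => ((s.subtype (· ∈ L.vertexSet)).map e.symm.toEmbedding).map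
      (Function.Embedding.subtype _), ?_, ?_, fun s hs => ⟨?_, ?_, ?_⟩, fun t ht => ⟨?_, ?_, ?_⟩⟩
  · intro s t hst
    exact Finset.map_subset_map.2 (Finset.map_subset_map.2 (Finset.subtype_mono hst))
  · intro s t hst
    exact Finset.map_subset_map.2 (Finset.map_subset_map.2 (Finset.subtype_mono hst))
  · rw [← he, hK s hs]
    exact hs
  · rw [Finset.card_map, Finset.card_map]
    conv_rhs => rw [← hK s hs, Finset.card_map]
  · conv_rhs => rw [← hK s hs]
    ext x
    simp
  · rw [he]
    convert! ht using 1
    conv_rhs => rw [← hL t ht]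
    congr 1
    ext x
    simp
  · rw [Finset.card_map, Finset.card_map]
    conv_rhs => rw [← hL t ht, Finset.card_map]
  · conv_rhs => rw [← hL t ht]
    ext x
    simp

theorem Isomorphic.isPure {K : PreAbstractSimplicialComplex V}
    {L : PreAbstractSimplicialComplex W} (h : K.Isomorphic L) {d : ℕ} (hK : K.IsPure d) :
    L.IsPure d := by
  obtain ⟨Φ, Ψ, hΦ, hΨ, h1, h2⟩ := h.exists_faceMap
  obtain ⟨⟨s, hs⟩, hcard, hpure⟩ := hK
  refine ⟨⟨_, (h1 s hs).1⟩, fun t ht => ?_, fun t ht => ?_⟩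
  · rw [← (h2 t ht).2.1]
    exact hcard _ (h2 t ht).1
  · obtain ⟨r, hr, htr, hrc⟩ := hpure _ (h2 t ht).1
    refine ⟨Φ r, (h1 r hr).1, ?_, (h1 r hr).2.1.trans hrc⟩
    have := hΦ htr
    rwa [(h2 t ht).2.2] at this

theorem Isomorphic.hasFreeRidge {K : PreAbstractSimplicialComplex V}
    {L : PreAbstractSimplicialComplex W} (h : K.Isomorphic L) {d : ℕ} (hK : K.HasFreeRidge d) :
    L.HasFreeRidge d := by
  obtain ⟨Φ, Ψ, hΦ, hΨ, h1, h2⟩ := h.exists_faceMap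
  obtain ⟨u, hu, s, hs, hus, huc, hsc, huniq⟩ := hK
  refine ⟨Φ u, (h1 u hu).1, Φ s, (h1 s hs).1, hΦ hus, (h1 u hu).2.1.trans huc,
    (h1 s hs).2.1.trans hsc, fun t ht hut htc => ?_⟩
  rw [← (h2 t ht).2.2, huniq _ (h2 t ht).1 ?_ ((h2 t ht).2.1.trans htc)]
  have := hΨ hut
  rwa [(h1 u hu).2.2] at this

variable {K : PreAbstractSimplicialComplex V} {K' : Geometry.SimplicialComplex ℝ (V →₀ ℝ)} {d : ℕ}

theorem IsSubdivision.isPure (h : IsSubdivision K' K.realization) (hK : K.IsPure d) :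
    K'.toPreAbstractSimplicialComplex.IsPure d := by
  obtain ⟨⟨T, hT⟩, hcard, hpure⟩ := hK
  obtain ⟨s, hs, -⟩ := h.exists_face_in_cell hT
  refine ⟨⟨s, hs⟩, fun t ht => ?_, fun t ht => ?_⟩
  · obtain ⟨U, hU, htU⟩ := h.exists_subset_cell ht
    exact (card_le_of_subset_cell (h.linearIndepOn ht) htU).trans (hcard U hU)
  · obtain ⟨U, hU, htU⟩ := h.exists_subset_cell ht
    obtain ⟨R, hR, hUR, hRc⟩ := hpure U hU
    obtain ⟨s', hs', hts, -, hc⟩ :=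
      h.exists_superset_card_eq hR ht fun p hp => cell_mono hUR (htU p hp)
    exact ⟨s', hs', hts, hc.trans hRc⟩

/-- A point in the interior of a cell. -/
theorem exists_mem_cell_support_eq {T : Finset V} (hT : T.Nonempty) :
    ∃ x ∈ cell T, x.support = T := by
  classical
  have hc : (T.card : ℝ) ≠ 0 := by exact_mod_cast hT.card_pos.ne'
  have hs : (Finsupp.indicator T fun _ _ => (T.card : ℝ)⁻¹).support = T := by
    ext v
    by_cases hv : v ∈ T <;> simp [hv, hT.ne_empty]
  refine ⟨_, ⟨fun v => ?_, ?_, hs.le⟩, hs⟩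
  · rw [indicator_apply]
    split_ifs <;> positivity
  · rw [coordSum_eq_sum hs.le, Finset.sum_congr rfl fun v hv => indicator_of_mem hv _]
    simp [hc]

/-- Purity descends from a subdivision: an interior point of `cell T` lies in a face of full
dimension, and the cell `cell U` that contains that face has `T` as a face. -/
theorem IsSubdivision.isPure_of_isPure (h : IsSubdivision K' K.realization)
    (hK' : K'.toPreAbstractSimplicialComplex.IsPure d) : K.IsPure d := by
  obtain ⟨⟨s, hs⟩, hcard, hpure⟩ := hK'
  obtain ⟨T, hT, -⟩ := h.exists_subset_cell hs
  have hle : ∀ T ∈ K.faces, T.card ≤ d + 1 := by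
    intro T hT
    obtain ⟨s, hs, hsT⟩ := h.exists_face_in_cell hT
    obtain ⟨s', hs', -, -, hc⟩ := h.exists_superset_card_eq hT hs hsT
    exact hc ▸ hcard s' hs'
  refine ⟨⟨T, hT⟩, hle, fun T hT => ?_⟩
  obtain ⟨x, hxT, hx⟩ := exists_mem_cell_support_eq (K.isRelLowerSet_faces hT).1
  obtain ⟨s, hs, hxs⟩ := Geometry.SimplicialComplex.mem_space_iff.1 (h.cell_subset_space hT hxT)
  obtain ⟨s', hs', hss, hc⟩ := hpure s hs
  obtain ⟨U, hU, hsU⟩ := h.exists_subset_cell hs'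
  have hxU := convexHull_subset_cell hsU (convexHull_mono (Finset.coe_subset.2 hss) hxs)
  refine ⟨U, hU, hx ▸ hxU.2.2, le_antisymm (hle U hU) ?_⟩
  rw [← hc]
  exact card_le_of_subset_cell (h.linearIndepOn hs') hsU

theorem isPure_standardSimplex (d : ℕ) : (standardSimplex d).IsPure d := by
  refine ⟨⟨Finset.range (d + 1), by simp, subset_rfl⟩, fun s hs => ?_, fun s hs => ?_⟩
  · simpa using Finset.card_le_card hs.2
  · exact ⟨Finset.range (d + 1), ⟨by simp, subset_rfl⟩, hs.2, by simp⟩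

theorem IsCombinatorialBall.isPure (h : K.IsCombinatorialBall d) : K.IsPure d := by
  obtain ⟨-, K', L', hK, hL, hiso⟩ := h
  exact hK.isPure_of_isPure (hiso.symm.isPure (hL.isPure (isPure_standardSimplex d)))

end Pure

/-! ### A sphere is not a ball -/

section Ridges

variable {V : Type*}

theorem barycenter_apply_pos {s : Finset (V →₀ ℝ)} {T : Finset V} (hs : s.Nonempty)
    (h : ∀ p ∈ s, p ∈ cell T) {v : V} {p : V →₀ ℝ} (hp : p ∈ s) (hpv : p v ≠ 0) :
    0 < barycenter s v := by
  have hc : (0 : ℝ) < s.card := by exact_mod_cast hs.card_pos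
  rw [barycenter, finsetSum_apply]
  refine Finset.sum_pos' (fun q hq => mul_nonneg (by positivity) ((h q hq).1 v)) ⟨p, hp, ?_⟩
  exact mul_pos (by positivity) (((h p hp).1 v).lt_of_ne' hpv)

/-- If the two faces `s` and `t` are joined to the ridge `u` from the same side, they overlap and
so coincide. Here `T` is a `d`-cell, and `u` lies on its facet `x_v = 0`. -/
theorem eq_of_ridge_on_boundary {K : PreAbstractSimplicialComplex V}
    {K' : Geometry.SimplicialComplex ℝ (V →₀ ℝ)} (h : IsSubdivision K' K.realization)
    {T : Finset V} {v : V} (hv : v ∈ T) {u s t : Finset (V →₀ ℝ)} (hu : u ∈ K'.faces)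
    (hs : s ∈ K'.faces) (ht : t ∈ K'.faces) (hus : u ⊆ s) (hut : u ⊆ t)
    (huT : ∀ p ∈ u, p v = 0) (hsT : ∀ p ∈ s, p ∈ cell T) (htT : ∀ p ∈ t, p ∈ cell T)
    (huc : u.card + 1 = T.card) (hsc : s.card = T.card) (htc : t.card = T.card) : t = s := by
  classical
  -- a face of full dimension has a vertex off the facet, which completes the ridge
  have key : ∀ r ∈ K'.faces, u ⊆ r → (∀ p ∈ r, p ∈ cell T) → r.card = T.card →
      ∃ a, a ∉ u ∧ 0 < a v ∧ r = insert a u := by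
    intro r hr hur hrT hrc
    obtain ⟨a, har, hau⟩ := Finset.exists_of_ssubset (hur.ssubset_of_ne (by rintro rfl; omega))
    have hreq : insert a u = r := Finset.eq_of_subset_of_card_le
      (Finset.insert_subset har hur) (by rw [Finset.card_insert_of_notMem hau]; omega)
    refine ⟨a, hau, ((hrT a har).1 v).lt_of_ne' fun ha0 => ?_, hreq.symm⟩
    have := card_le_of_subset_cell (T := T.erase v) (h.linearIndepOn hr) fun p hp => by
      refine mem_cell_of_apply_eq_zero (hrT p hp).1 (hrT p hp).2.1 fun w hw => ?_
      by_cases hwv : w = v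
      · subst hwv
        rw [← hreq, Finset.mem_insert] at hp
        rcases hp with rfl | hp
        · exact ha0
        · exact huT p hp
      · exact apply_eq_zero_of_mem_cell (hrT p hp) fun hwT => hw (Finset.mem_erase.2 ⟨hwv, hwT⟩)
    rw [Finset.card_erase_of_mem hv] at this
    have := Finset.card_pos.2 ⟨v, hv⟩
    omega
  obtain ⟨a, hau, hav, hsa⟩ := key s hs hus hsT hsc
  obtain ⟨b, hbu, hbv, htb⟩ := key t ht hut htT htc
  have has : a ∈ s := hsa ▸ Finset.mem_insert_self a u
  have hbt : b ∈ t := htb ▸ Finset.mem_insert_self b u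
  have hune := K'.nonempty_of_mem_faces hu
  obtain ⟨c, hc⟩ := exists_coordinates (h.linearIndepOn ht)
  have hx := barycenter_mem_convexHull hune
  have hxt := convexHull_mono (Finset.coe_subset.2 hut) hx
  have hxs := convexHull_mono (Finset.coe_subset.2 hus) hx
  have hxv : barycenter u v = 0 := by
    rw [barycenter, finsetSum_apply]
    exact Finset.sum_eq_zero fun p hp => by simp [huT p hp]
  have hat : a ∈ Submodule.span ℝ (t : Set (V →₀ ℝ)) := by
    rw [span_eq_span_single (h.linearIndepOn ht) htT htc]
    have := hsT a has
    rw [← convexHull_image_single] at this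
    exact convexHull_subset_span _ this
  -- the coordinate of `a` at the vertex `b` is positive, as `b` alone is off the facet
  have hcb : 0 < c b a := by
    obtain ⟨w, -, hw⟩ := Submodule.mem_span_finset.1 hat
    have h1 : c b a = w b := by rw [← hw]; exact hc w b hbt
    have h2 : a v = w b * b v := by
      have h3 := congrArg (fun z : V →₀ ℝ => z v) hw
      simp only [finsetSum_apply] at h3
      rw [htb, Finset.sum_insert hbu, Finset.sum_eq_zero, add_zero] at h3
      · exact h3.symm
      · intro p hp
        simp [huT p hp]
    rw [h1]
    by_contra! hneg
    nlinarith
  have hcx : ∀ p ∈ t, c p (barycenter u) = if p ∈ u then (u.card : ℝ)⁻¹ else 0 := by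
    intro p hp
    rw [← hc (fun q => if q ∈ u then (u.card : ℝ)⁻¹ else 0) p hp, barycenter]
    congr 1
    rw [← Finset.sum_subset hut]
    · exact Finset.sum_congr rfl fun q hq => by simp [hq]
    · intro q _ hq
      simp [hq]
  have hucard : (0 : ℝ) < u.card := by exact_mod_cast hune.card_pos
  obtain ⟨ε, hε, hε1, hnn⟩ := exists_pos_forall_add_mul_nonneg u
    (fun p => c p (barycenter u)) (fun p => c p (a - barycenter u))
    fun p hp => by rw [hcx p (hut hp), if_pos hp]; positivity
  have hzs : barycenter u + ε • (a - barycenter u) ∈ convexHull ℝ (s : Set (V →₀ ℝ)) := by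
    have := (convex_convexHull ℝ (s : Set (V →₀ ℝ))) hxs
      (subset_convexHull ℝ _ has) (sub_nonneg.2 hε1) hε.le (by ring)
    convert! this using 1
    module
  have hzt : barycenter u + ε • (a - barycenter u) ∈ convexHull ℝ (t : Set (V →₀ ℝ)) := by
    refine mem_convexHull_of_coordinates (φ := coordSum)
      (fun p hp => h.coordSum_eq_one ht hp) hc ?_ ?_ fun p hp => ?_
    · have hx' := convexHull_subset_span _ hxt
      exact Submodule.add_mem _ hx' (Submodule.smul_mem _ _ (Submodule.sub_mem _ hat hx'))
    · exact (convexHull_subset_cell hsT hzs).2.1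
    · by_cases hpu : p ∈ u
      · have := hnn p hpu
        simpa using this
      · have hpb : p = b := by
          rw [htb, Finset.mem_insert] at hp
          exact hp.resolve_right hpu
        rw [map_add, map_smul, map_sub, hcx p hp, if_neg hpu, hpb]
        simp only [smul_eq_mul, zero_add, sub_zero]
        positivity
  have hz := K'.inter_subset_convexHull hs ht ⟨hzs, hzt⟩
  have hzv : 0 < (barycenter u + ε • (a - barycenter u)) v := by
    simp [hxv, hε, hav]
  by_contra hne
  have hsub : (s ∩ t : Set (V →₀ ℝ)) ⊆ (u : Set (V →₀ ℝ)) := by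
    rintro p ⟨hps, hpt⟩
    rw [Finset.mem_coe] at hps hpt ⊢
    rw [hsa, Finset.mem_insert] at hps
    rw [htb, Finset.mem_insert] at hpt
    rcases hps with rfl | hps
    · rcases hpt with rfl | hpt
      · exact absurd (htb.trans hsa.symm) hne
      · exact hpt
    · exact hps
  have hzu := convexHull_mono hsub hz
  obtain ⟨w, -, -, hw⟩ := Finset.mem_convexHull'.1 hzu
  have := congrArg (fun z : V →₀ ℝ => z v) hw
  simp only [finsetSum_apply] at this
  rw [Finset.sum_eq_zero fun p hp => by simp [huT p hp]] at this
  exact hzv.ne this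

/-- A face of dimension `d - 1` inside the facet `{0, …, d - 1}` of `Δ^d` is free. -/
theorem IsSubdivision.hasFreeRidge {K' : Geometry.SimplicialComplex ℝ (ℕ →₀ ℝ)} {d : ℕ}
    (h : IsSubdivision K' (standardSimplex d).realization) (hd : 0 < d) :
    K'.toPreAbstractSimplicialComplex.HasFreeRidge d := by
  have hT : Finset.range (d + 1) ∈ (standardSimplex d).faces := ⟨by simp, subset_rfl⟩
  have hF : Finset.range d ∈ (standardSimplex d).faces :=
    ⟨by simpa using hd.ne', Finset.range_subset_range.2 (by omega)⟩
  obtain ⟨u₀, hu₀, hu₀F⟩ := h.exists_face_in_cell hF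
  obtain ⟨u, hu, -, huF, huc⟩ := h.exists_superset_card_eq hF hu₀ hu₀F
  obtain ⟨s, hs, hus, hsT, hsc⟩ := h.exists_superset_card_eq hT hu fun p hp =>
    cell_mono hF.2 (huF p hp)
  refine ⟨u, hu, s, hs, hus, by simpa using huc, by simpa using hsc, fun t ht hut htc => ?_⟩
  have htT : ∀ p ∈ t, p ∈ cell (Finset.range (d + 1)) := by
    obtain ⟨U, hU, htU⟩ := h.exists_subset_cell ht
    exact fun p hp => cell_mono hU.2 (htU p hp)
  refine eq_of_ridge_on_boundary h (v := d) (by simp) hu hs ht hus hut (fun p hp => ?_) hsT htT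
    ?_ hsc (by simpa using htc)
  · exact apply_eq_zero_of_mem_cell (huF p hp) (by simp)
  · simp [huc]

/-- In a subdivision of the boundary of a `(d+1)`-simplex every ridge can be left on two sides: if
its barycentre is in the interior of a facet, move from there in the direction opposite to a given
`d`-face; otherwise pass to the other facet. -/
theorem IsSubdivision.not_hasFreeRidge_of_boundary {W : Finset V} {d : ℕ} (hW : W.card = d + 2)
    {K' : Geometry.SimplicialComplex ℝ (V →₀ ℝ)}
    (h : IsSubdivision K' (boundary W).realization)
    (hpure : K'.toPreAbstractSimplicialComplex.IsPure d) :
    ¬ K'.toPreAbstractSimplicialComplex.HasFreeRidge d := by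
  classical
  rintro ⟨u, hu, s, hs, hus, huc, hsc, huniq⟩
  change u ∈ K'.faces at hu
  change s ∈ K'.faces at hs
  have hune := K'.nonempty_of_mem_faces hu
  obtain ⟨T, hT, hsT⟩ := h.exists_subset_cell hs
  have huT : ∀ p ∈ u, p ∈ cell T := fun p hp => hsT p (hus hp)
  have hTc : T.card = d + 1 := by
    have := card_le_of_subset_cell (h.linearIndepOn hs) hsT
    have := Finset.card_lt_card hT.2
    omega
  by_cases hint : ∀ v ∈ T, 0 < barycenter u v
  · obtain ⟨a, has, hau⟩ := Finset.exists_of_ssubset (hus.ssubset_of_ne (by rintro rfl; omega))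
    have haT := hsT a has
    obtain ⟨ε, hε, -, hnn⟩ := exists_pos_forall_add_mul_nonneg T
      (fun v => barycenter u v) (fun v => (barycenter u - a) v) hint
    have hxT := convexHull_subset_cell huT (barycenter_mem_convexHull hune)
    have hyT : barycenter u + ε • (barycenter u - a) ∈ cell T := by
      have hout : ∀ v, v ∉ T → (barycenter u + ε • (barycenter u - a)) v = 0 := fun v hv => by
        simp [apply_eq_zero_of_mem_cell hxT hv, apply_eq_zero_of_mem_cell haT hv]
      refine mem_cell_of_apply_eq_zero (fun v => ?_) ?_ hout
      · by_cases hv : v ∈ T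
        · exact hnn v hv
        · exact (hout v hv).ge
      · simp [hxT.2.1, haT.2.1]
    have hseg : ∀ n : ℕ, barycenter u + (1 / ((n : ℝ) + 1)) • (ε • (barycenter u - a)) ∈
        cell T := by
      intro n
      have h1 : 1 / ((n : ℝ) + 1) ≤ 1 := by
        rw [div_le_one (by positivity)]; linarith [(Nat.cast_nonneg n : (0 : ℝ) ≤ n)]
      have := convex_cell T hxT hyT (sub_nonneg.2 h1)
        (by positivity : 0 ≤ 1 / ((n : ℝ) + 1)) (by ring)
      convert! this using 1
      module
    obtain ⟨t, ht, hxt, δ, hδ, hyt⟩ := exists_face_contains_initial_segment h.1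
      (fun s hs p hp => h.coordSum_eq_one hs hp) (fun s hs => h.linearIndepOn hs) hxT.2.1
      (fun n => h.cell_subset_space hT (hseg n))
    have hut := subset_of_barycenter_mem hu (h.linearIndepOn hu) ht hxt
    obtain ⟨r, hr, htr, hrc⟩ := hpure.2.2 t ht
    have hrs := huniq r hr (hut.trans htr) hrc
    subst hrs
    -- the coordinate at `a` is negative beyond the ridge
    obtain ⟨c, hc⟩ := exists_coordinates (h.linearIndepOn hs)
    have h0 := coordinates_nonneg hc (convexHull_mono (Finset.coe_subset.2 htr) hyt) has
    have hca : c a a = 1 := by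
      have := hc (fun q => if q = a then 1 else 0) a has
      simpa [has] using this
    have hcx : c a (barycenter u) = 0 := by
      have := hc (fun q => if q ∈ u then (u.card : ℝ)⁻¹ else 0) a has
      rw [if_neg hau] at this
      rw [← this, barycenter]
      congr 1
      rw [← Finset.sum_subset hus]
      · exact Finset.sum_congr rfl fun q hq => by simp [hq]
      · intro q _ hq
        simp [hq]
    rw [map_add, map_smul, map_smul, map_sub, hca, hcx] at h0
    simp only [smul_eq_mul] at h0
    nlinarith [mul_pos hδ hε]
  · push Not at hint
    obtain ⟨v, hvT, hv⟩ := hint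
    have hu0 : ∀ p ∈ u, p v = 0 := by
      intro p hp
      by_contra hpv
      exact absurd (barycenter_apply_pos hune huT hp hpv) (not_lt.2 hv)
    have hvW := hT.2.subset hvT
    have hT2 : W.erase v ∈ (boundary W).faces := by
      refine ⟨?_, Finset.erase_ssubset hvW⟩
      rw [← Finset.card_pos, Finset.card_erase_of_mem hvW]
      omega
    have huT2 : ∀ p ∈ u, p ∈ cell (W.erase v) := by
      intro p hp
      refine mem_cell_of_apply_eq_zero (huT p hp).1 (huT p hp).2.1 fun w hw => ?_
      by_cases hwv : w = v
      · rw [hwv]; exact hu0 p hp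
      · exact apply_eq_zero_of_mem_cell (huT p hp) fun hwT =>
          hw (Finset.mem_erase.2 ⟨hwv, hT.2.subset hwT⟩)
    obtain ⟨t, ht, hut, htT2, htc⟩ := h.exists_superset_card_eq hT2 hu huT2
    rw [Finset.card_erase_of_mem hvW, hW] at htc
    have hts := huniq t ht hut htc
    subst hts
    have := card_le_of_subset_cell (T := T.erase v) (h.linearIndepOn hs) fun p hp => by
      refine mem_cell_of_apply_eq_zero (hsT p hp).1 (hsT p hp).2.1 fun w hw => ?_
      by_cases hwv : w = v
      · exact apply_eq_zero_of_mem_cell (htT2 p hp) (by simp [hwv])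
      · exact apply_eq_zero_of_mem_cell (hsT p hp) fun hwT => hw (Finset.mem_erase.2 ⟨hwv, hwT⟩)
    rw [Finset.card_erase_of_mem hvT] at this
    omega

theorem not_isCombinatorialBall_boundary {W : Finset V} {d : ℕ} (hW : W.card = d + 2) :
    ¬ (boundary W).IsCombinatorialBall d := by
  classical
  intro hB
  have hpure := hB.isPure
  obtain ⟨-, K', L', hK, hL, hiso⟩ := hB
  rcases Nat.eq_zero_or_pos d with rfl | hd
  · -- a subdivision of a point is a point, but `∂Δ¹` consists of two points
    obtain ⟨Φ, Ψ, -, -, h1, h2⟩ := hiso.exists_faceMap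
    have hone : ∀ s ∈ L'.faces, s = {single 0 1} := by
      intro s hs
      obtain ⟨U, hU, hsU⟩ := hL.exists_subset_cell hs
      refine (Finset.eq_singleton_iff_nonempty_unique_mem).2
        ⟨L'.nonempty_of_mem_faces hs, fun p hp => ?_⟩
      have hp' := cell_mono hU.2 (hsU p hp)
      have h3 := hp'.2.1
      rw [coordSum_eq_sum hp'.2.2] at h3
      ext v
      by_cases hv : v = 0
      · subst hv; simpa using h3
      · rw [apply_eq_zero_of_mem_cell hp' (by simpa using hv)]
        simp [Ne.symm hv]
    obtain ⟨v, w, hvw, rfl⟩ := Finset.card_eq_two.1 hW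
    have hface : ∀ x ∈ ({v, w} : Finset V), {x} ∈ (boundary {v, w}).faces := by
      intro x hx
      refine ⟨Finset.singleton_nonempty x, (Finset.singleton_subset_iff.2 hx).ssubset_of_ne ?_⟩
      intro h
      have := congrArg Finset.card h
      rw [hW] at this
      simp at this
    obtain ⟨s, hs, hsv⟩ := hK.exists_face_in_cell (hface v (by simp))
    obtain ⟨t, ht, htw⟩ := hK.exists_face_in_cell (hface w (by simp))
    have hst : s = t := by
      rw [← (h1 s hs).2.2, ← (h1 t ht).2.2, hone _ (h1 s hs).1, hone _ (h1 t ht).1]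
    subst hst
    obtain ⟨p, hp⟩ := K'.nonempty_of_mem_faces hs
    obtain ⟨x, hx⟩ := support_nonempty_of_mem_cell (hsv p hp)
    have h3 := (hsv p hp).2.2 hx
    have h4 := (htw p hp).2.2 hx
    rw [Finset.mem_singleton] at h3 h4
    exact hvw (h3.symm.trans h4)
  · exact hK.not_hasFreeRidge_of_boundary hW (hK.isPure hpure)
      (hiso.symm.hasFreeRidge (hL.hasFreeRidge hd))

end Ridges

/-! ### Isomorphisms -/

section Isomorphisms

variable {V W : Type*}

theorem isomorphic_of_injOn [DecidableEq W] {K : PreAbstractSimplicialComplex V}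
    {L : PreAbstractSimplicialComplex W} (f : V → W) (hf : Set.InjOn f K.vertexSet)
    (hKL : ∀ s ∈ K.faces, s.image f ∈ L.faces)
    (hLK : ∀ t ∈ L.faces, ∃ s ∈ K.faces, s.image f = t) : K.Isomorphic L := by
  let g : K.vertexSet → L.vertexSet := fun v => ⟨f v, by
    have := hKL _ v.2
    rwa [Finset.image_singleton] at this⟩
  have hg : Function.Bijective g := by
    refine ⟨fun v w h => Subtype.ext (hf v.2 w.2 (congrArg Subtype.val h)), fun w => ?_⟩
    obtain ⟨s, hs, hsw⟩ := hLK _ w.2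
    have hw : (w : W) ∈ s.image f := hsw ▸ Finset.mem_singleton_self _
    obtain ⟨v, hv, hvw⟩ := Finset.mem_image.1 hw
    exact ⟨⟨v, subset_vertexSet hs v hv⟩, Subtype.ext hvw⟩
  have himage : ∀ s : Finset K.vertexSet, (s.map (Equiv.ofBijective g hg).toEmbedding).map
      (Function.Embedding.subtype _) = (s.map (Function.Embedding.subtype _)).image f := by
    intro s
    rw [← Finset.coe_inj]
    simp only [Finset.coe_map, Finset.coe_image, Set.image_image]
    rfl
  refine ⟨Equiv.ofBijective g hg, fun s => ⟨fun hs => ?_, fun hs => ?_⟩⟩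
  · rw [himage]
    exact hKL _ hs
  · rw [himage] at hs
    obtain ⟨t, ht, hts⟩ := hLK _ hs
    have : t = s.map (Function.Embedding.subtype _) := by
      rw [← Finset.coe_inj]
      refine (hf.image_eq_image_iff (fun v hv => subset_vertexSet ht v hv) ?_).1 ?_
      · intro v hv
        simp only [Finset.coe_map, Set.mem_image, Function.Embedding.subtype_apply] at hv
        obtain ⟨w, -, rfl⟩ := hv
        exact w.2
      · rw [← Finset.coe_image, ← Finset.coe_image, hts]
    rwa [← this]

theorem Isomorphic.trans {U : Type*} {K : PreAbstractSimplicialComplex V}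
    {L : PreAbstractSimplicialComplex W} {M : PreAbstractSimplicialComplex U}
    (h : K.Isomorphic L) (h' : L.Isomorphic M) : K.Isomorphic M := by
  obtain ⟨e, he⟩ := h
  obtain ⟨e', he'⟩ := h'
  refine ⟨e.trans e', fun s => ?_⟩
  rw [he, he', Finset.map_map e.toEmbedding]
  rfl

theorem Isomorphic.ncard_vertexSet {K : PreAbstractSimplicialComplex V}
    {L : PreAbstractSimplicialComplex W} (h : K.Isomorphic L) :
    K.vertexSet.ncard = L.vertexSet.ncard :=
  Nat.card_congr h.choose

theorem vertexSet_simplex (S : Finset V) : (simplex S).vertexSet = S := by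
  ext v
  simp [vertexSet, simplex]

theorem simplex_isomorphic [DecidableEq W] {S : Finset V} {f : V → W} (hf : Set.InjOn f S) :
    (simplex S).Isomorphic (simplex (S.image f)) := by
  refine isomorphic_of_injOn f (by rwa [vertexSet_simplex])
    (fun s hs => ⟨hs.1.image f, Finset.image_subset_image hs.2⟩) fun t ht => ?_
  obtain ⟨s, hs, rfl⟩ := Finset.subset_image_iff.1 ht.2
  exact ⟨s, ⟨Finset.image_nonempty.1 ht.1, hs⟩, rfl⟩

end Isomorphisms

/-! ### The join of the boundary of a simplex with a simplex -/

section BoundaryJoin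

variable {V W : Type*}

/-- For `T ⊆ S`, the complex `∂Δ(T) ∗ Δ(S \ T)`, given by its simplices: the subsets of `S` that do
not contain `T`. -/
def boundaryJoin (T S : Finset V) : PreAbstractSimplicialComplex V where
  faces := {s | s.Nonempty ∧ s ⊆ S ∧ ¬ T ⊆ s}
  isRelLowerSet_faces := fun _ hs =>
    ⟨hs.1, fun _ ht hn => ⟨hn, ht.trans hs.2.1, fun h => hs.2.2 (h.trans ht)⟩⟩

theorem finite_boundaryJoin_faces (T S : Finset V) : (boundaryJoin T S).faces.Finite :=
  (S.powerset.finite_toSet).subset fun _ hs => Finset.mem_coe.2 (Finset.mem_powerset.2 hs.2.1)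

theorem boundaryJoin_self (S : Finset V) : boundaryJoin S S = boundary S :=
  PreAbstractSimplicialComplex.ext rfl

theorem boundaryJoin_singleton [DecidableEq V] (v : V) (S : Finset V) :
    boundaryJoin {v} S = simplex (S.erase v) := by
  ext s
  simp only [boundaryJoin, simplex, Set.mem_ofPred_eq, Finset.singleton_subset_iff,
    Finset.subset_erase]

theorem boundaryJoin_isomorphic [DecidableEq W] {T S : Finset V} (hT : T ⊆ S) {f : V → W}
    (hf : Set.InjOn f S) :
    (boundaryJoin T S).Isomorphic (boundaryJoin (T.image f) (S.image f)) := by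
  have key : ∀ s ⊆ S, (T.image f ⊆ s.image f ↔ T ⊆ s) := fun s hs => by
    rw [← Finset.coe_subset, Finset.coe_image, Finset.coe_image,
      hf.image_subset_image_iff (Finset.coe_subset.2 hT) (Finset.coe_subset.2 hs),
      Finset.coe_subset]
  refine isomorphic_of_injOn f (hf.mono fun v hv => ?_) (fun s hs => ?_) fun t ht => ?_
  · exact Finset.singleton_subset_iff.1 hv.2.1
  · exact ⟨hs.1.image f, Finset.image_subset_image hs.2.1, fun h => hs.2.2 ((key s hs.2.1).1 h)⟩
  · obtain ⟨s, hs, rfl⟩ := Finset.subset_image_iff.1 ht.2.1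
    exact ⟨s, ⟨Finset.image_nonempty.1 ht.1, hs, fun h => ht.2.2 ((key s hs).2 h)⟩, rfl⟩

theorem starring_simplex [DecidableEq V] {τ R : Finset V} {a : V} (hτ : τ.Nonempty) (hτR : τ ⊆ R)
    (ha : a ∉ R) : starring τ a (simplex R) = boundaryJoin τ (insert a R) := by
  ext u
  simp only [starring, closedStar, join, link, simplex, boundary, boundaryJoin, Set.mem_union,
    Set.mem_sdiff, Set.mem_ofPred_eq]
  constructor
  · rintro (⟨⟨hu, huR⟩, hst⟩ | ⟨hu, s, t, hs, ht, rfl⟩)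
    · refine absurd ⟨hu, u ∩ τ, u \ τ, ?_, ?_, ?_⟩ hst
      · rcases (u ∩ τ).eq_empty_or_nonempty with h | h
        · exact Or.inl h
        · exact Or.inr ⟨h, Finset.inter_subset_right⟩
      · rcases (u \ τ).eq_empty_or_nonempty with h | h
        · exact Or.inl h
        · refine Or.inr ⟨h, Finset.sdiff_disjoint, h.mono Finset.subset_union_left, ?_⟩
          exact Finset.union_subset (Finset.sdiff_subset.trans huR) hτR
      · rw [Finset.union_comm, Finset.sdiff_union_inter]
    · have haτ : a ∉ τ := fun h => ha (hτR h)
      have hs' : s ⊆ {a} := by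
        rcases hs with rfl | hs
        · exact Finset.empty_subset _
        · exact hs.2
      have ht' : t ⊆ R ∧ ¬ τ ⊆ t := by
        rcases ht with rfl | ⟨-, p, q, hp, hq, rfl⟩
        · exact ⟨Finset.empty_subset _, fun h => hτ.ne_empty (Finset.subset_empty.1 h)⟩
        · have hp' : p ⊂ τ := by
            rcases hp with rfl | hp
            · exact Finset.empty_ssubset.2 hτ
            · exact hp.2
          have hq' : Disjoint q τ ∧ q ⊆ R := by
            rcases hq with rfl | hq
            · simp
            · exact ⟨hq.2.1, Finset.subset_union_left.trans hq.2.2.2⟩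
          refine ⟨Finset.union_subset (hp'.subset.trans hτR) hq'.2, fun h => hp'.2 fun v hv => ?_⟩
          exact (Finset.mem_union.1 (h hv)).resolve_right
            fun hvq => Finset.disjoint_left.1 hq'.1 hvq hv
      grind
  · rintro ⟨hu, huR, huτ⟩
    refine Or.inr ⟨hu, u ∩ {a}, u \ {a}, ?_, ?_, by grind⟩
    · rcases (u ∩ {a}).eq_empty_or_nonempty with h | h
      · exact Or.inl h
      · exact Or.inr ⟨h, Finset.inter_subset_right⟩
    · rcases (u \ {a}).eq_empty_or_nonempty with h | h
      · exact Or.inl h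
      · refine Or.inr ⟨h, (u \ {a}) ∩ τ, (u \ {a}) \ τ, ?_, ?_, by grind⟩
        · rcases ((u \ {a}) ∩ τ).eq_empty_or_nonempty with h' | h'
          · exact Or.inl h'
          · refine Or.inr ⟨h', Finset.inter_subset_right, fun h'' => huτ ?_⟩
            exact h''.trans (Finset.inter_subset_left.trans Finset.sdiff_subset)
        · rcases ((u \ {a}) \ τ).eq_empty_or_nonempty with h' | h'
          · exact Or.inl h'
          · refine Or.inr ⟨h', Finset.sdiff_disjoint, h'.mono Finset.subset_union_left, ?_⟩
            refine Finset.union_subset (fun v hv => ?_) hτR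
            grind

/-- If a pure `d`-dimensional complex has `d + 2` vertices, each of its facets is the complement of a
single vertex. The vertices that occur in this way form the set `T`. -/
theorem IsPure.eq_simplex_or_eq_boundaryJoin {B : PreAbstractSimplicialComplex V} {d : ℕ}
    (hB : B.IsPure d) (hfin : B.vertexSet.Finite) (hcard : B.vertexSet.ncard ≤ d + 2) :
    (∃ S : Finset V, S.card = d + 1 ∧ B = simplex S) ∨
      ∃ T S : Finset V, T.Nonempty ∧ T ⊆ S ∧ S.card = d + 2 ∧ B.vertexSet = S ∧
        B = boundaryJoin T S := by
  classical
  obtain ⟨⟨s₀, hs₀⟩, -, hpure⟩ := hB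
  have hsub : ∀ s ∈ B.faces, s ⊆ hfin.toFinset := fun s hs v hv =>
    hfin.mem_toFinset.2 (subset_vertexSet hs v hv)
  rw [Set.ncard_eq_toFinset_card _ hfin] at hcard
  obtain ⟨t₀, ht₀, -, ht₀c⟩ := hpure s₀ hs₀
  have hle := Finset.card_le_card (hsub t₀ ht₀)
  rcases (by omega : hfin.toFinset.card = d + 1 ∨ hfin.toFinset.card = d + 2) with hc | hc
  · left
    have htop : t₀ = hfin.toFinset := Finset.eq_of_subset_of_card_le (hsub t₀ ht₀) (by omega)
    refine ⟨t₀, ht₀c, PreAbstractSimplicialComplex.ext (Set.ext fun s => ⟨fun hs => ?_, ?_⟩)⟩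
    · exact ⟨(B.isRelLowerSet_faces hs).1, htop ▸ hsub s hs⟩
    · exact fun hs => (B.isRelLowerSet_faces ht₀).2 hs.2 hs.1
  · right
    have hcompl : ∀ t ∈ B.faces, t.card = d + 1 → ∃ v ∈ hfin.toFinset,
        t = hfin.toFinset.erase v := by
      intro t ht htc
      obtain ⟨v, hv, hvt⟩ := Finset.exists_of_ssubset
        ((hsub t ht).ssubset_of_ne (by rintro h; rw [h] at htc; omega))
      refine ⟨v, hv, Finset.eq_of_subset_of_card_le (Finset.subset_erase.2 ⟨hsub t ht, hvt⟩) ?_⟩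
      rw [Finset.card_erase_of_mem hv]
      omega
    refine ⟨hfin.toFinset.filter fun v => hfin.toFinset.erase v ∈ B.faces, hfin.toFinset, ?_,
      Finset.filter_subset _ _, hc, hfin.coe_toFinset.symm,
      PreAbstractSimplicialComplex.ext (Set.ext fun s => ⟨fun hs => ?_, ?_⟩)⟩
    · obtain ⟨v, hv, hvt⟩ := hcompl t₀ ht₀ ht₀c
      exact ⟨v, Finset.mem_filter.2 ⟨hv, hvt ▸ ht₀⟩⟩
    · refine ⟨(B.isRelLowerSet_faces hs).1, hsub s hs, fun hT => ?_⟩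
      obtain ⟨t, ht, hst, htc⟩ := hpure s hs
      obtain ⟨v, hv, rfl⟩ := hcompl t ht htc
      exact absurd (hst (hT (Finset.mem_filter.2 ⟨hv, ht⟩))) (Finset.notMem_erase v _)
    · rintro ⟨hne, hsS, hT⟩
      obtain ⟨v, hv, hvs⟩ := Finset.not_subset.1 hT
      exact (B.isRelLowerSet_faces (Finset.mem_filter.1 hv).2).2
        (Finset.subset_erase.2 ⟨hsS, hvs⟩) hne

end BoundaryJoin

/-! ### Starrings of a simplex are balls -/

section LinearImage

variable {E F : Type*} [AddCommGroup E] [Module ℝ E] [AddCommGroup F] [Module ℝ F]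

/-- Moving inside the simplex from a barycentre in the direction of an affine dependence of the
images would contradict injectivity. -/
theorem affineIndependent_comp_of_injOn {s : Finset E} (hs : AffineIndependent ℝ ((↑) : s → E))
    (f : E →ₗ[ℝ] F) (hf : Set.InjOn f (convexHull ℝ (s : Set E))) :
    AffineIndependent ℝ fun p : s => f p := by
  rw [affineIndependent_iff]
  intro t w hw hfw i hi
  have hcard : (0 : ℝ) < t.card := by exact_mod_cast Finset.card_pos.2 ⟨i, hi⟩
  obtain ⟨ε, hε, -, hnn⟩ := exists_pos_forall_add_mul_nonneg t
    (fun _ => (t.card : ℝ)⁻¹) w fun _ _ => by positivity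
  have hsum : ∑ i ∈ t, (t.card : ℝ)⁻¹ = 1 := by simp [hcard.ne']
  have hx : ∑ i ∈ t, (t.card : ℝ)⁻¹ • (i : E) ∈ convexHull ℝ (s : Set E) :=
    (convex_convexHull ℝ _).sum_mem (fun _ _ => by positivity) hsum
      fun i _ => subset_convexHull ℝ _ i.2
  have hy : ∑ i ∈ t, ((t.card : ℝ)⁻¹ + ε * w i) • (i : E) ∈ convexHull ℝ (s : Set E) :=
    (convex_convexHull ℝ _).sum_mem hnn
      (by rw [Finset.sum_add_distrib, hsum, ← Finset.mul_sum, hw]; simp)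
      fun i _ => subset_convexHull ℝ _ i.2
  have hdecomp : ∑ i ∈ t, ((t.card : ℝ)⁻¹ + ε * w i) • (i : E) =
      ∑ i ∈ t, (t.card : ℝ)⁻¹ • (i : E) + ε • ∑ i ∈ t, w i • (i : E) := by
    rw [Finset.smul_sum, ← Finset.sum_add_distrib]
    exact Finset.sum_congr rfl fun i _ => by rw [add_smul, mul_smul]
  have hfeq : f (∑ i ∈ t, w i • (i : E)) = 0 := by
    rw [map_sum, ← hfw]
    exact Finset.sum_congr rfl fun i _ => by simp
  have h1 := hf hy hx (by rw [hdecomp, map_add, map_smul, hfeq, smul_zero, add_zero])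
  rw [hdecomp, add_eq_left, smul_eq_zero, or_iff_right hε.ne'] at h1
  exact affineIndependent_iff.1 hs t w hw h1 i hi

open Classical in
/-- The image of a geometric simplicial complex under a linear map that is injective on its
underlying space. -/
noncomputable def linearImage (K : Geometry.SimplicialComplex ℝ E) (f : E →ₗ[ℝ] F)
    (hf : Set.InjOn f K.space) : Geometry.SimplicialComplex ℝ F where
  toPreAbstractSimplicialComplex := K.toPreAbstractSimplicialComplex.map f
  indep := by
    rintro _ ⟨s, hs, rfl⟩
    have h1 := (affineIndependent_comp_of_injOn (K.indep hs) f
      (hf.mono (Geometry.SimplicialComplex.convexHull_subset_space hs))).range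
    refine h1.mono ?_
    intro y hy
    obtain ⟨x, hx, rfl⟩ := Finset.mem_image.1 hy
    exact ⟨⟨x, hx⟩, rfl⟩
  inter_subset_convexHull := by
    rintro _ _ ⟨s, hs, rfl⟩ ⟨t, ht, rfl⟩ y ⟨hys, hyt⟩
    rw [Finset.coe_image, ← f.image_convexHull] at hys hyt
    obtain ⟨x, hx, rfl⟩ := hys
    obtain ⟨x', hx', hxx⟩ := hyt
    have := hf (Geometry.SimplicialComplex.convexHull_subset_space ht hx')
      (Geometry.SimplicialComplex.convexHull_subset_space hs hx) hxx
    subst this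
    have h1 := Set.mem_image_of_mem f (K.inter_subset_convexHull hs ht ⟨hx, hx'⟩)
    rw [f.image_convexHull] at h1
    refine convexHull_mono ?_ h1
    rw [Finset.coe_image, Finset.coe_image]
    exact Set.image_inter_subset _ _ _

theorem linearImage_space (K : Geometry.SimplicialComplex ℝ E) (f : E →ₗ[ℝ] F)
    (hf : Set.InjOn f K.space) : (linearImage K f hf).space = f '' K.space := by
  classical
  ext y
  simp only [Geometry.SimplicialComplex.mem_space_iff, Set.mem_image]
  constructor
  · rintro ⟨_, ⟨s, hs, rfl⟩, hy⟩
    rw [Finset.coe_image, ← f.image_convexHull] at hy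
    obtain ⟨x, hx, rfl⟩ := hy
    exact ⟨x, ⟨s, hs, hx⟩, rfl⟩
  · rintro ⟨x, ⟨s, hs, hx⟩, rfl⟩
    refine ⟨_, ⟨s, hs, rfl⟩, ?_⟩
    rw [Finset.coe_image, ← f.image_convexHull]
    exact Set.mem_image_of_mem f hx

theorem isomorphic_linearImage (K : Geometry.SimplicialComplex ℝ E) (f : E →ₗ[ℝ] F)
    (hf : Set.InjOn f K.space) :
    K.toPreAbstractSimplicialComplex.Isomorphic
      (linearImage K f hf).toPreAbstractSimplicialComplex := by
  classical
  refine isomorphic_of_injOn f (hf.mono K.vertices_subset_space) (fun s hs => ?_) fun t ht => ?_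
  · exact ⟨s, hs, rfl⟩
  · obtain ⟨s, hs, rfl⟩ := ht
    exact ⟨s, hs, rfl⟩

end LinearImage

/-- The elementary starring of a simplex is a ball: sending the new vertex `a` to the barycentre of
`τ` maps its realization bijectively onto the simplex. A point of the simplex is recovered from its
image, since the coordinate at `a` is determined by the smallest coordinate in `τ`. -/
theorem isCombinatorialBall_boundaryJoin {d a : ℕ} {τ : Finset ℕ} (hτ : τ.Nonempty)
    (hτd : τ ⊆ Finset.range (d + 1)) (ha : a ∉ Finset.range (d + 1)) :
    (boundaryJoin τ (insert a (Finset.range (d + 1)))).IsCombinatorialBall d := by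
  set R := Finset.range (d + 1)
  set K := boundaryJoin τ (insert a R)
  have hc : (0 : ℝ) < τ.card := by exact_mod_cast hτ.card_pos
  set β : ℝ := (τ.card : ℝ)⁻¹
  have hβ : 0 < β := by positivity
  set b : ℕ →₀ ℝ := ∑ v ∈ τ, single v β
  have hbv : ∀ v, b v = if v ∈ τ then β else 0 := fun v => by
    simp [b, finsetSum_apply, single_apply]
  have hb1 : coordSum b = 1 := by
    simp [b, coordSum, β, hc.ne']
  have haτ : a ∉ τ := fun h => ha (hτd h)
  let f : (ℕ →₀ ℝ) →ₗ[ℝ] (ℕ →₀ ℝ) :=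
    LinearMap.id + (lapply a : (ℕ →₀ ℝ) →ₗ[ℝ] ℝ).smulRight (b - single a 1)
  have hf : ∀ x, f x = x + x a • (b - single a 1) := fun x => rfl
  have hfa : ∀ x, f x a = 0 := fun x => by simp [hf, hbv, haτ]
  have hfv : ∀ x v, v ≠ a → f x v = x v + x a * (if v ∈ τ then β else 0) := fun x v hv => by
    simp [hf, hbv, Ne.symm hv]
  have hspace : ∀ x, x ∈ K.realization.space ↔
      (∀ v, 0 ≤ x v) ∧ coordSum x = 1 ∧ x.support ⊆ insert a R ∧ ∃ v ∈ τ, x v = 0 := by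
    intro x
    rw [mem_realization_space]
    constructor
    · rintro ⟨T, hT, hx⟩
      obtain ⟨v, hv, hvT⟩ := Finset.not_subset.1 hT.2.2
      exact ⟨hx.1, hx.2.1, hx.2.2.trans hT.2.1, v, hv, apply_eq_zero_of_mem_cell hx hvT⟩
    · rintro ⟨h0, h1, hsub, v, hv, hxv⟩
      have hx : x ∈ cell x.support := ⟨h0, h1, subset_rfl⟩
      refine ⟨x.support, ⟨support_nonempty_of_mem_cell hx, hsub, fun h => ?_⟩, hx⟩
      exact mem_support_iff.1 (h hv) hxv
  have hle : ∀ x ∈ K.realization.space, ∀ y ∈ K.realization.space, f x = f y → x a ≤ y a := by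
    intro x hx y hy hxy
    rw [hspace] at hx hy
    obtain ⟨v, hv, hyv⟩ := hy.2.2.2
    have h1 := congrArg (fun z : ℕ →₀ ℝ => z v) hxy
    have hva : v ≠ a := fun h => haτ (h ▸ hv)
    simp only [hfv _ v hva, if_pos hv, hyv, zero_add] at h1
    exact le_of_mul_le_mul_right (by linarith [hx.1 v]) hβ
  have hinj : Set.InjOn f K.realization.space := by
    intro x hx y hy hxy
    have h1 := le_antisymm (hle x hx y hy hxy) (hle y hy x hx hxy.symm)
    rw [hf, hf, h1] at hxy
    exact add_right_cancel hxy
  have himage : f '' K.realization.space = cell R := by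
    ext z
    constructor
    · rintro ⟨x, hx, rfl⟩
      rw [hspace] at hx
      refine mem_cell_of_apply_eq_zero (fun v => ?_) ?_ fun v hv => ?_
      · by_cases hva : v = a
        · rw [hva, hfa]
        · rw [hfv x v hva]
          have := hx.1 v
          have := hx.1 a
          split_ifs <;> positivity
      · rw [hf, map_add, map_smul, map_sub, hb1, coordSum_single, hx.2.1]
        simp
      · by_cases hva : v = a
        · rw [hva, hfa]
        · rw [hfv x v hva, if_neg fun h => hv (hτd h), mul_zero, add_zero]
          refine notMem_support_iff.1 fun h => ?_
          exact (Finset.mem_insert.1 (hx.2.2.1 h)).elim hva hv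
    · intro hz
      -- the coordinate of the preimage at `a` makes its smallest coordinate in `τ` vanish
      obtain ⟨v₀, hv₀, hmin⟩ := Finset.exists_min_image τ z hτ
      have hza := apply_eq_zero_of_mem_cell hz ha
      let x : ℕ →₀ ℝ := z - (z v₀ / β) • (b - single a 1)
      have hx : ∀ v, v ≠ a → x v =
          z v - if v ∈ τ then z v₀ else 0 := by
        intro v hva
        by_cases hv : v ∈ τ <;> simp [x, hbv, hv, Ne.symm hva, hβ.ne']
      have hxa : x a = z v₀ / β := by
        simp [x, hbv, haτ, hza]
      refine ⟨x, (hspace _).2 ⟨fun v => ?_, ?_, ?_, v₀, hv₀, ?_⟩, ?_⟩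
      · by_cases hva : v = a
        · rw [hva, hxa]
          exact div_nonneg (hz.1 v₀) hβ.le
        · rw [hx v hva]
          split_ifs with hv
          · exact sub_nonneg.2 (hmin v hv)
          · simpa using hz.1 v
      · simp [x, hb1, coordSum_single, hz.2.1]
      · intro v hv
        by_contra hvR
        rw [Finset.mem_insert, not_or] at hvR
        refine mem_support_iff.1 hv ?_
        rw [hx v hvR.1, apply_eq_zero_of_mem_cell hz hvR.2, if_neg fun h => hvR.2 (hτd h), sub_zero]
      · rw [hx v₀ fun h => haτ (h ▸ hv₀), if_pos hv₀, sub_self]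
      · rw [hf, hxa, sub_add_cancel]
  have hfin : K.realization.faces.Finite := (finite_boundaryJoin_faces _ _).image _
  refine ⟨finite_boundaryJoin_faces _ _, K.realization, linearImage _ f hinj,
    ⟨hfin, rfl, fun s hs => ⟨s, hs, subset_rfl⟩⟩, ⟨hfin.image _, ?_, ?_⟩,
    isomorphic_linearImage _ f hinj⟩
  · rw [linearImage_space, himage]
    ext x
    rw [mem_realization_space]
    exact ⟨fun h => ⟨R, ⟨by simp [R], subset_rfl⟩, h⟩, fun ⟨T, hT, h⟩ => cell_mono hT.2 h⟩
  · intro s hs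
    obtain ⟨t, ht, htR⟩ := exists_mem_realization_faces (K := standardSimplex d) (T := R)
      ⟨by simp [R], subset_rfl⟩
    refine ⟨t, ht, ?_⟩
    rw [htR, convexHull_image_single, ← himage, ← linearImage_space _ f hinj]
    exact Geometry.SimplicialComplex.convexHull_subset_space hs

/-! ### Balls with few vertices -/

theorem exists_injOn_image_eq {V W : Type*} [DecidableEq W] [Nonempty W] {S : Finset V}
    {S' : Finset W} (h : S.card = S'.card) : ∃ f : V → W, Set.InjOn f S ∧ S.image f = S' := by
  obtain ⟨f, hf⟩ := S.finite_toSet.exists_bijOn_of_encard_eq (t := (S' : Set W))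
    (by rw [Set.encard_coe_eq_coe_finsetCard, Set.encard_coe_eq_coe_finsetCard, h])
  exact ⟨f, hf.injOn, by rw [← Finset.coe_inj, Finset.coe_image, hf.image_eq]⟩

theorem starring_standardSimplex {d a : ℕ} {τ : Finset ℕ} (hτ : τ ∈ (standardSimplex d).faces)
    (ha : a ∉ (standardSimplex d).vertexSet) :
    starring τ a (standardSimplex d) = boundaryJoin τ (insert a (Finset.range (d + 1))) := by
  rw [standardSimplex, vertexSet_simplex, Finset.mem_coe] at ha
  exact starring_simplex hτ.1 hτ.2 ha

theorem IsCombinatorialBall.finite_vertexSet {V : Type*} {d : ℕ}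
    {B : PreAbstractSimplicialComplex V} (hB : B.IsCombinatorialBall d) : B.vertexSet.Finite :=
  hB.1.preimage (Finset.singleton_injective.injOn)

/-- A ball with at most `d + 2` vertices is a starring of the simplex: the only other pure complex
is the boundary of a simplex, which is not a ball. -/
theorem IsCombinatorialBall.exists_isomorphic_starring {V : Type*} {d : ℕ}
    {B : PreAbstractSimplicialComplex V} (hB : B.IsCombinatorialBall d)
    (hcard : B.vertexSet.ncard ≤ d + 2) :
    ∃ (τ : Finset ℕ) (a : ℕ), τ ∈ (standardSimplex d).faces ∧
      a ∉ (standardSimplex d).vertexSet ∧ B.Isomorphic (starring τ a (standardSimplex d)) := by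
  classical
  have hlast : d + 1 ∉ (standardSimplex d).vertexSet := by
    simp [standardSimplex, vertexSet_simplex]
  rcases hB.isPure.eq_simplex_or_eq_boundaryJoin hB.finite_vertexSet hcard with
    ⟨S, hS, rfl⟩ | ⟨T, S, hT, hTS, hS, -, rfl⟩
  · have h0 : {0} ∈ (standardSimplex d).faces := ⟨by simp, by simp⟩
    refine ⟨{0}, d + 1, h0, hlast, ?_⟩
    rw [starring_standardSimplex h0 hlast, boundaryJoin_singleton]
    obtain ⟨f, hf, himage⟩ := exists_injOn_image_eq (S := S)
      (S' := (insert (d + 1) (Finset.range (d + 1))).erase 0) (by simp [hS])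
    rw [← himage]
    exact simplex_isomorphic hf
  · have hne : T ≠ S := by
      rintro rfl
      rw [boundaryJoin_self] at hB
      exact not_isCombinatorialBall_boundary hS hB
    obtain ⟨v, hv, hvT⟩ := Finset.exists_of_ssubset (hTS.ssubset_of_ne hne)
    -- number the vertices so that `v`, which is not in `T`, becomes the new vertex of the starring
    obtain ⟨g, hg, himage⟩ := exists_injOn_image_eq
      (S := S.erase v) (S' := Finset.range (d + 1)) (by simp [Finset.card_erase_of_mem hv, hS])
    have hgmem : ∀ w ∈ S.erase v, g w ∈ Finset.range (d + 1) := fun w hw =>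
      himage ▸ Finset.mem_image_of_mem g hw
    have himage' : S.image (Function.update g v (d + 1)) =
        insert (d + 1) (Finset.range (d + 1)) := by
      rw [← Finset.insert_erase hv, Finset.image_insert, Function.update_self, ← himage]
      congr 1
      exact Finset.image_congr fun w hw =>
        Function.update_of_ne (Finset.ne_of_mem_erase (Finset.mem_coe.1 hw)) _ _
    have hf : Set.InjOn (Function.update g v (d + 1)) S := by
      rw [← Finset.card_image_iff, himage', hS]
      simp
    have hτ : T.image (Function.update g v (d + 1)) ∈ (standardSimplex d).faces := by
      refine ⟨hT.image _, fun x hx => ?_⟩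
      obtain ⟨w, hw, rfl⟩ := Finset.mem_image.1 hx
      have hwv : w ≠ v := fun h => hvT (h ▸ hw)
      rw [Function.update_of_ne hwv]
      exact hgmem w (Finset.mem_erase.2 ⟨hwv, hTS hw⟩)
    refine ⟨_, d + 1, hτ, hlast, ?_⟩
    rw [starring_standardSimplex hτ hlast, ← himage']
    exact boundaryJoin_isomorphic hTS hf

/-- With `S = {0, …, d + 1}`, the complement in `∂Δ(S)` of the ball `∂Δ(T) ∗ Δ(S \ T)` is the ball
`Δ(T) ∗ ∂Δ(S \ T)`. -/
theorem exists_complementary_ball {d a : ℕ} {τ : Finset ℕ} (hτ : τ ∈ (standardSimplex d).faces)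
    (ha : a ∉ (standardSimplex d).vertexSet) :
    ∃ B' L : PreAbstractSimplicialComplex ℕ,
      (starring τ a (standardSimplex d)).Isomorphic B' ∧ L.IsCombinatorialBall d ∧
        B' ⊔ L = standardBoundary (d + 1) := by
  rw [starring_standardSimplex hτ ha]
  rw [standardSimplex, vertexSet_simplex, Finset.mem_coe] at ha
  set R := Finset.range (d + 1) with hR
  have hτR : τ ⊆ R := hτ.2
  obtain ⟨u, hu⟩ := hτ.1
  have huR := hτR hu
  have hd : d + 1 ∉ R := by simp [hR]
  have hua : u ≠ a := fun h => ha (h ▸ huR)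
  -- relabel so that the vertex `d + 1` comes from `τ`, and is the new vertex of a starring
  let g : ℕ → ℕ := fun v => if v = a then u else if v = u then d + 1 else v
  have hga : g a = u := if_pos rfl
  have hgu : g u = d + 1 := by simp [g, hua]
  have hgv : ∀ v, v ≠ a → v ≠ u → g v = v := fun v h h' => by simp [g, h, h']
  have himage : (insert a R).image g = insert (d + 1) R := by
    ext w
    simp only [Finset.mem_image, Finset.mem_insert]
    constructor
    · rintro ⟨v, rfl | hv, rfl⟩
      · exact Or.inr (hga ▸ huR)
      · by_cases hvu : v = u
        · exact Or.inl (hvu ▸ hgu)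
        · exact Or.inr ((hgv v (fun h => ha (h ▸ hv)) hvu).symm ▸ hv)
    · rintro (rfl | hw)
      · exact ⟨u, Or.inr huR, hgu⟩
      · by_cases hwu : w = u
        · exact ⟨a, Or.inl rfl, hwu ▸ hga⟩
        · exact ⟨w, Or.inr hw, hgv w (fun h => ha (h ▸ hw)) hwu⟩
  have hg : Set.InjOn g (insert a R : Finset ℕ) := by
    rw [← Finset.card_image_iff, himage, Finset.card_insert_of_notMem ha,
      Finset.card_insert_of_notMem hd]
  have hiso := boundaryJoin_isomorphic (hτR.trans (Finset.subset_insert a R)) hg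
  have hdτ : d + 1 ∈ τ.image g := hgu ▸ Finset.mem_image_of_mem g hu
  have huτ : u ∉ τ.image g := by
    intro h
    obtain ⟨v, hv, hvu⟩ := Finset.mem_image.1 h
    have hva : v ≠ a := fun h => ha (h ▸ hτR hv)
    by_cases hvu' : v = u
    · rw [hvu', hgu] at hvu
      exact hd (hvu ▸ huR)
    · exact hvu' ((hgv v hva hvu').symm.trans hvu)
  refine ⟨boundaryJoin (τ.image g) (insert (d + 1) R),
    boundaryJoin (insert (d + 1) R \ τ.image g) (insert (d + 1) R), ?_, ?_, ?_⟩
  · rwa [himage] at hiso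
  · refine isCombinatorialBall_boundaryJoin ⟨u, ?_⟩ ?_ hd
    · exact Finset.mem_sdiff.2 ⟨Finset.mem_insert_of_mem huR, huτ⟩
    · intro v hv
      rw [Finset.mem_sdiff, Finset.mem_insert] at hv
      exact hv.1.resolve_left fun h => hv.2 (h ▸ hdτ)
  · have hgsub : τ.image g ⊆ insert (d + 1) R := by
      rw [← himage]
      exact Finset.image_subset_image (hτR.trans (Finset.subset_insert a R))
    have hS : insert (d + 1) R = Finset.range (d + 1 + 1) := (Finset.range_add_one).symm
    rw [standardBoundary, ← hS]
    refine PreAbstractSimplicialComplex.ext (Set.ext fun s => ⟨?_, fun hs => ?_⟩)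
    · rintro (⟨h1, h2, h3⟩ | ⟨h1, h2, h3⟩)
      · exact ⟨h1, h2, fun h => h3 (hgsub.trans h)⟩
      · exact ⟨h1, h2, fun h => h3 (Finset.sdiff_subset.trans h)⟩
    · by_cases h : τ.image g ⊆ s
      · refine Or.inr ⟨hs.1, hs.2.subset, fun h' => hs.2.2 fun v hv => ?_⟩
        by_cases hvτ : v ∈ τ.image g
        · exact h hvτ
        · exact h' (Finset.mem_sdiff.2 ⟨hv, hvτ⟩)
      · exact Or.inl ⟨hs.1, hs.2.subset, h⟩

theorem IsPure.ncard_vertexSet_le_of_isVertexMinimal {V : Type*} {d : ℕ}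
    {B : PreAbstractSimplicialComplex V} (hB : B.IsPure d) (h : B.IsVertexMinimal) :
    B.vertexSet.ncard ≤ d + 2 := by
  rcases h with ⟨S, rfl⟩ | ⟨n, ⟨⟨s, hs, hsc⟩, -⟩, hcard⟩
  · obtain ⟨⟨s, hs⟩, hle, -⟩ := hB
    have := hle S ⟨hs.1.mono hs.2, subset_rfl⟩
    rw [vertexSet_simplex, Set.ncard_coe_finset]
    omega
  · have := hB.2.1 s hs
    omega

theorem IsPure.isVertexMinimal_of_ncard_vertexSet_le {V : Type*} {d : ℕ}
    {B : PreAbstractSimplicialComplex V} (hB : B.IsPure d) (hfin : B.vertexSet.Finite)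
    (h : B.vertexSet.ncard ≤ d + 2) : B.IsVertexMinimal := by
  rcases hB.eq_simplex_or_eq_boundaryJoin hfin h with ⟨S, -, rfl⟩ | ⟨-, S, -, -, hS, hBS, -⟩
  · exact Or.inl ⟨S, rfl⟩
  · obtain ⟨⟨s, hs⟩, hle, hpure⟩ := hB
    obtain ⟨t, ht, -, htc⟩ := hpure s hs
    exact Or.inr ⟨d, ⟨⟨t, ht, htc⟩, hle⟩, by rw [hBS, Set.ncard_coe_finset, hS]⟩

theorem Isomorphic.ncard_vertexSet_le_of_sup_eq_standardBoundary {V : Type*} {d : ℕ}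
    {B : PreAbstractSimplicialComplex V} {B' L : PreAbstractSimplicialComplex ℕ}
    (hB : B.Isomorphic B') (h : B' ⊔ L = standardBoundary (d + 1)) :
    B.vertexSet.ncard ≤ d + 2 := by
  have hsub : B'.vertexSet ⊆ (Finset.range (d + 2) : Finset ℕ) := by
    intro v hv
    have : {v} ∈ (standardBoundary (d + 1)).faces := h ▸ Or.inl hv
    exact Finset.singleton_subset_iff.1 this.2.subset
  rw [hB.ncard_vertexSet]
  have := Set.ncard_le_ncard hsub (Finset.finite_toSet _)
  rwa [Set.ncard_coe_finset, Finset.card_range] at this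

end PreAbstractSimplicialComplex

theorem mainTheorem7 {V : Type*} (d : ℕ) (B : PreAbstractSimplicialComplex V)
    (hB : B.IsCombinatorialBall d) :
    List.TFAE [
      B.vertexSet.ncard ≤ d + 2,
      B.IsVertexMinimal,
      ∃ (τ : Finset ℕ) (a : ℕ),
        τ ∈ (PreAbstractSimplicialComplex.standardSimplex d).faces ∧
        a ∉ (PreAbstractSimplicialComplex.standardSimplex d).vertexSet ∧
        B.Isomorphic
          (PreAbstractSimplicialComplex.starring τ a (PreAbstractSimplicialComplex.standardSimplex d)),
      ∃ B' L : PreAbstractSimplicialComplex ℕ,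
        B.Isomorphic B' ∧ L.IsCombinatorialBall d ∧
        B' ⊔ L = PreAbstractSimplicialComplex.standardBoundary (d + 1)] := by
  tfae_have 1 → 2 := hB.isPure.isVertexMinimal_of_ncard_vertexSet_le hB.finite_vertexSet
  tfae_have 2 → 1 := hB.isPure.ncard_vertexSet_le_of_isVertexMinimal
  tfae_have 1 → 3 := hB.exists_isomorphic_starring
  tfae_have 3 → 4 := by
    rintro ⟨τ, a, hτ, ha, hBτ⟩
    obtain ⟨B', L, hB', hL, hBL⟩ :=
      PreAbstractSimplicialComplex.exists_complementary_ball hτ ha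
    exact ⟨B', L, hBτ.trans hB', hL, hBL⟩
  tfae_have 4 → 1 := by
    rintro ⟨B', L, hB', -, hBL⟩
    exact hB'.ncard_vertexSet_le_of_sup_eq_standardBoundary hBL
  tfae_finish
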